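/- Let $W_2^n[0,1]$ be the complex Sobolev space of functions on $[0,1]$ with derivatives up to order $n$ in $L_2[0,1]$, and let $W_2^{-n}[0,1]$ be the space of bounded antilinear functionals on $W_2^n[0,1]$; write $\langle f,z\rangle$ for the value of $f$ at $z$. A functional is called real if it takes real values on real-valued functions. A continuous function $g$ on $[0,1]$ is identified with the functional $z\mapsto\int_0^1 g\,\overline{z}\,dx$, and $\delta_t$ denotes the functional $z\mapsto\overline{z(t)}$. Let $p\in L_\infty[0,1]$ be real and uniformly positive ($p\ge c$ almost everywhere for some constant $c>0$), and let $q\in W_2^{-1}[0,1]$ and $h\in W_2^{-2}[0,1]$ be real. Let $L\colon W_2^2[0,1]\to W_2^{-2}[0,1]$ be the operator given by $$\langle Ly,z\rangle=\int_0^1 p\,y''\,\overline{z''}\,dx+\langle q,\overline{y'}z'\rangle+\langle h,\overline{y}z\rangle .$$ Suppose that $L$ is positive definite, that is, $\langle Ly,y\rangle>0$ for all $y\ne0$ (for such operators this is equivalent to $\langle Ly,y\rangle\ge c\|y\|^2$ with some $c>0$), and that its Green function $G(t,s)=\overline{\langle\delta_t,L^{-1}\delta_s\rangle}$ is uniformly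 positive on the closed square: there is a constant $c>0$ with $G(t,s)\ge c$ for all $(t,s)\in[0,1]\times[0,1]$. Then $L$ does not decrease the number of sign changes: for every real-valued $y\in W_2^2[0,1]$, the number of sign changes of $y$ does not exceed the number of sign changes of $Ly$. Here the number of sign changes of a real function $g$ on $[0,1]$ is the supremum of those $n\ge 0$ for which there are points $\xi_0<\xi_1<\dots<\xi_n$ of $[0,1]$ with $g(\xi_k)g(\xi_{k+1})<0$ for $0\le k<n$. A functional $f\in W_2^{-2}[0,1]$ has at most $n$ sign changes if it is a limit, in the norm of $W_2^{-2}[0,1]$, of real continuous functions having at most $n$ sign changes; its number of sign changes is the least such $n$ ($\infty$ if there is none). -/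

import Mathlib

open MeasureTheory Set
open scoped ENNReal InnerProductSpace ComplexConjugate
noncomputable section
namespace SobolevInterval

/-- Lebesgue measure on `[0,1]`. -/
abbrev unitMeasure : Measure ℝ := volume.restrict (Icc 0 1)
/-- The complex space `L_2[0,1]`. -/
abbrev L2 : Type := Lp ℂ 2 unitMeasure
/-- `x ↦ ∫_0^x w dt`, for functions given on `[0,1]` (constant continuation outside `[0,1]`). -/
def primitive (w : ℝ → ℂ) (x : ℝ) : ℂ := ∫ t in (0 : ℝ)..x, w t ∂unitMeasure

/-- If `IsPrimitive v w`, this is the continuous representative of `v`: the first summand is the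
constant `a` in `v = a + ∫_0^x w`, see `contRep_eq` and `IsPrimitive.ae_eq_contRep`. -/
def contRep (v w : L2) (x : ℝ) : ℂ :=
  (∫ s, (v s - primitive w s) ∂unitMeasure) + primitive w x

/-- `v` coincides almost everywhere on `[0,1]` with an absolutely continuous function whose
derivative is `w`; equivalently, `w` is the weak derivative of `v`. -/
def IsPrimitive (v w : L2) : Prop :=
  ∃ a : ℂ, v =ᵐ[unitMeasure] fun x => a + primitive w x

instance : IsProbabilityMeasure unitMeasure := ⟨by simp⟩

lemma L2.integrable (w : L2) : Integrable w unitMeasure :=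
  (Lp.memLp w).integrable (by norm_num)

lemma L2.integral_norm_le (w : L2) : ∫ x, ‖w x‖ ∂unitMeasure ≤ ‖w‖ := by
  rw [integral_norm_eq_lintegral_enorm (Lp.aestronglyMeasurable w), Lp.norm_def,
    ← eLpNorm_one_eq_lintegral_enorm]
  exact ENNReal.toReal_mono (Lp.eLpNorm_ne_top w)
    (eLpNorm_le_eLpNorm_of_exponent_le (by norm_num) (Lp.aestronglyMeasurable w))

lemma norm_primitive_le (w : L2) (x : ℝ) : ‖primitive w x‖ ≤ ‖w‖ := by
  refine le_trans (intervalIntegral.norm_integral_le_integral_norm_uIoc) ?_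
  refine le_trans (setIntegral_le_integral (L2.integrable w).norm ?_) (L2.integral_norm_le w)
  exact Filter.Eventually.of_forall fun _ => norm_nonneg _

lemma continuous_primitive {w : ℝ → ℂ} (hw : Integrable w unitMeasure) :
    Continuous (primitive w) :=
  intervalIntegral.continuous_primitive (fun _ _ => hw.intervalIntegrable) 0

lemma primitive_add (v w : L2) (x : ℝ) :
    primitive (v + w : L2) x = primitive v x + primitive w x := by
  unfold primitive
  rw [← intervalIntegral.integral_add (L2.integrable v).intervalIntegrable
    (L2.integrable w).intervalIntegrable]
  refine intervalIntegral.integral_congr_ae_restrict (ae_restrict_of_ae ?_)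
  exact Lp.coeFn_add v w

lemma primitive_smul (c : ℂ) (w : L2) (x : ℝ) :
    primitive (c • w : L2) x = c * primitive w x := by
  unfold primitive
  rw [← intervalIntegral.integral_const_mul]
  refine intervalIntegral.integral_congr_ae_restrict (ae_restrict_of_ae ?_)
  exact Lp.coeFn_smul c w

lemma integrable_primitive (w : L2) : Integrable (primitive w) unitMeasure :=
  Integrable.of_bound (continuous_primitive (L2.integrable w)).aestronglyMeasurable ‖w‖
    (Filter.Eventually.of_forall (norm_primitive_le w))

lemma continuous_contRep (v w : L2) : Continuous (contRep v w) :=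
  continuous_const.add (continuous_primitive (L2.integrable w))

lemma contRep_eq {v w : L2} {a : ℂ}
    (h : v =ᵐ[unitMeasure] fun x => a + primitive w x) (x : ℝ) :
    contRep v w x = a + primitive w x := by
  have : ∫ s, (v s - primitive w s) ∂unitMeasure = ∫ _, a ∂unitMeasure := by
    refine integral_congr_ae ?_
    filter_upwards [h] with s hs
    rw [hs]; ring
  rw [contRep, this]; simp

lemma IsPrimitive.ae_eq_contRep {v w : L2} (h : IsPrimitive v w) :
    v =ᵐ[unitMeasure] contRep v w := by
  obtain ⟨a, ha⟩ := h
  filter_upwards [ha] with x hx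
  rw [hx, contRep_eq ha]

lemma norm_contRep_le (v w : L2) (x : ℝ) : ‖contRep v w x‖ ≤ ‖v‖ + 2 * ‖w‖ := by
  have h1 : ‖∫ s, (v s - primitive w s) ∂unitMeasure‖ ≤ ‖v‖ + ‖w‖ := by
    rw [integral_sub (L2.integrable v) (integrable_primitive w)]
    refine (norm_sub_le _ _).trans (add_le_add ?_ ?_)
    · exact (norm_integral_le_integral_norm _).trans (L2.integral_norm_le v)
    · simpa using norm_integral_le_of_norm_le_const (μ := unitMeasure)
        (Filter.Eventually.of_forall (norm_primitive_le w))
  calc _ ≤ _ := norm_add_le _ _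
    _ ≤ _ := add_le_add h1 (norm_primitive_le w x)
    _ = _ := by ring

lemma contRep_add (v w v' w' : L2) (x : ℝ) :
    contRep (v + v') (w + w') x = contRep v w x + contRep v' w' x := by
  have h : ∫ s, ((v + v' : L2) s - primitive (w + w' : L2) s) ∂unitMeasure =
      (∫ s, (v s - primitive w s) ∂unitMeasure) + ∫ s, (v' s - primitive w' s) ∂unitMeasure := by
    have := integral_add ((L2.integrable v).sub (integrable_primitive w))
      ((L2.integrable v').sub (integrable_primitive w'))
    simp only [Pi.sub_apply] at this
    rw [← this]
    refine integral_congr_ae ?_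
    filter_upwards [Lp.coeFn_add v v'] with s hs
    rw [hs, primitive_add]; simp; ring
  rw [contRep, h, primitive_add, contRep, contRep]; ring

lemma contRep_smul (c : ℂ) (v w : L2) (x : ℝ) :
    contRep (c • v) (c • w) x = c * contRep v w x := by
  have h : ∫ s, ((c • v : L2) s - primitive (c • w : L2) s) ∂unitMeasure =
      c * ∫ s, (v s - primitive w s) ∂unitMeasure := by
    rw [← integral_const_mul]
    refine integral_congr_ae ?_
    filter_upwards [Lp.coeFn_smul c v] with s hs
    rw [hs, primitive_smul]; simp; ring
  rw [contRep, h, primitive_smul, contRep]; ring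

/-- The functions of class `W_2^n[0,1]`, recorded together with their weak derivatives as tuples
`(u, D u, …, D^n u)` in `L_2[0,1]`; the norm is `(∑ i ≤ n, ‖D^i u‖²)^{1/2}`. -/
def sobolevSubmodule (n : ℕ) : Submodule ℂ (PiLp 2 fun _ : Fin (n + 1) => L2) where
  carrier := {u | ∀ i : Fin n, IsPrimitive (u i.castSucc) (u i.succ)}
  zero_mem' i := ⟨0, by
    filter_upwards [Lp.coeFn_zero ℂ 2 unitMeasure] with x hx
    have : primitive (0 : L2) x = 0 := by simpa using primitive_smul 0 0 x
    rw [PiLp.zero_apply, PiLp.zero_apply, this, hx]; simp⟩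
  add_mem' {u v} hu hv i := by
    obtain ⟨a, ha⟩ := hu i
    obtain ⟨b, hb⟩ := hv i
    refine ⟨a + b, ?_⟩
    filter_upwards [ha, hb, Lp.coeFn_add (u i.castSucc) (v i.castSucc)] with x h1 h2 h3
    rw [PiLp.add_apply, PiLp.add_apply, h3, primitive_add, Pi.add_apply, h1, h2]; ring
  smul_mem' c u hu i := by
    obtain ⟨a, ha⟩ := hu i
    refine ⟨c * a, ?_⟩
    filter_upwards [ha, Lp.coeFn_smul c (u i.castSucc)] with x h1 h3
    rw [PiLp.smul_apply, PiLp.smul_apply, h3, primitive_smul, Pi.smul_apply, h1, smul_eq_mul]; ring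

/-- The complex Sobolev space `W_2^n[0,1]`. -/
abbrev Sob (n : ℕ) : Type := sobolevSubmodule n

/-- The `i`-th weak derivative of `u`. -/
abbrev Sob.wderiv {n : ℕ} (u : Sob n) (i : Fin (n + 1)) : L2 := u.1 i

/-- The continuous representative of `u`. -/
def Sob.eval {n : ℕ} (u : Sob (n + 1)) : ℝ → ℂ := contRep (u.wderiv 0) (u.wderiv 1)

/-- The space `W_2^{-n}[0,1]`, dual to `W_2^n[0,1]`: bounded antilinear functionals, so that
`⟨f, z⟩` is written `f z` and is linear in `f` and antilinear in `z`. -/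
abbrev SobDual (n : ℕ) : Type := Sob n →L⋆[ℂ] ℂ

lemma Sob.norm_wderiv_le {n : ℕ} (u : Sob n) (i : Fin (n + 1)) : ‖u.wderiv i‖ ≤ ‖u‖ :=
  PiLp.norm_apply_le u.1 i

lemma Sob.norm_eval_le {n : ℕ} (u : Sob (n + 1)) (x : ℝ) : ‖u.eval x‖ ≤ 3 * ‖u‖ := by
  refine (norm_contRep_le _ _ x).trans ?_
  linarith [u.norm_wderiv_le 0, u.norm_wderiv_le 1]

/-- The Dirac distribution at `t`: `⟨δ_t, z⟩` is the complex conjugate of `z(t)`. -/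
def delta (t : ℝ) : SobDual 2 :=
  LinearMap.mkContinuous
    { toFun := fun z => conj (z.eval t)
      map_add' := fun y z => by
        simp only [Sob.eval, ← map_add]
        exact congrArg conj (contRep_add _ _ _ _ t)
      map_smul' := fun c z => by
        simp only [Sob.eval, smul_eq_mul, ← map_mul]
        exact congrArg conj (contRep_smul _ _ _ t) }
    3 (fun z => by simpa using z.norm_eval_le t)

/-- The derivative `W_2^{n+1}[0,1] → W_2^n[0,1]`. -/
def Sob.derivative {n : ℕ} (u : Sob (n + 1)) : Sob n :=
  ⟨WithLp.toLp 2 fun i => u.wderiv i.succ, fun i => by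
    have := u.2 i.succ
    rwa [← Fin.succ_castSucc] at this⟩

lemma Sob.norm_derivative_le {n : ℕ} (u : Sob (n + 1)) : ‖u.derivative‖ ≤ ‖u‖ := by
  have h : ‖u.derivative‖ ^ 2 ≤ ‖u‖ ^ 2 := by
    change ‖u.derivative.1‖ ^ 2 ≤ ‖u.1‖ ^ 2
    rw [PiLp.norm_sq_eq_of_L2, PiLp.norm_sq_eq_of_L2, Fin.sum_univ_succ (n := n + 1)]
    exact le_add_of_nonneg_left (sq_nonneg _)
  exact (sq_le_sq₀ (norm_nonneg _) (norm_nonneg _)).1 h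

/-! ### Products -/

lemma primitive_eq {w : ℝ → ℂ} {x : ℝ} (hx : x ∈ Icc (0 : ℝ) 1) :
    primitive w x = ∫ t in (0 : ℝ)..x, w t := by
  rw [primitive, intervalIntegral.integral_of_le hx.1, intervalIntegral.integral_of_le hx.1,
    Measure.restrict_restrict_of_subset
      (Ioc_subset_Icc_self.trans (Icc_subset_Icc_right hx.2))]


lemma absolutelyContinuous_integral {f : ℝ → ℂ} (hf : Integrable f) :
    AbsolutelyContinuousOnInterval (fun x => ∫ t in (0 : ℝ)..x, f t) 0 1 := by
  have h1 := hf.re.intervalIntegrable.absolutelyContinuousOnInterval_intervalIntegral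
    (a := 0) (b := 1) (c := 0) (by simp)
  have h2 := hf.im.intervalIntegrable.absolutelyContinuousOnInterval_intervalIntegral
    (a := 0) (b := 1) (c := 0) (by simp)
  have hc (c : ℂ) : AbsolutelyContinuousOnInterval (fun _ : ℝ => c) 0 1 :=
    ((LipschitzWith.const c).lipschitzOnWith (s := uIcc (0 : ℝ) 1)).absolutelyContinuousOnInterval
  convert! (h1.smul (hc 1)).add (h2.smul (hc Complex.I)) using 1
  funext x
  have e1 : ∫ t in (0 : ℝ)..x, RCLike.re (f t) = (∫ t in (0 : ℝ)..x, f t).re :=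
    intervalIntegral.intervalIntegral_re hf.intervalIntegrable
  have e2 : ∫ t in (0 : ℝ)..x, RCLike.im (f t) = (∫ t in (0 : ℝ)..x, f t).im :=
    intervalIntegral.intervalIntegral_im hf.intervalIntegrable
  simp only [Pi.add_apply, Pi.smul_apply', e1, e2]
  simp [Complex.re_add_im]

lemma integral_product_rule {f g : ℝ → ℂ} (hf : Integrable f) (hg : Integrable g) (a b : ℂ)
    {x : ℝ} (hx : x ∈ Icc (0 : ℝ) 1) :
    (a + ∫ t in (0 : ℝ)..x, f t) * (b + ∫ t in (0 : ℝ)..x, g t) = a * b +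
      ∫ t in (0 : ℝ)..x, (f t * (b + ∫ s in (0 : ℝ)..t, g s) +
        (a + ∫ s in (0 : ℝ)..t, f s) * g t) := by
  set F : ℝ → ℂ := fun x => a + ∫ t in (0 : ℝ)..x, f t with hF
  set G : ℝ → ℂ := fun x => b + ∫ t in (0 : ℝ)..x, g t with hG
  have hc (c : ℂ) : AbsolutelyContinuousOnInterval (fun _ : ℝ => c) 0 1 :=
    ((LipschitzWith.const c).lipschitzOnWith (s := uIcc (0 : ℝ) 1)).absolutelyContinuousOnInterval
  have aF : AbsolutelyContinuousOnInterval F 0 1 := (hc a).add (absolutelyContinuous_integral hf)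
  have aG : AbsolutelyContinuousOnInterval G 0 1 := (hc b).add (absolutelyContinuous_integral hg)
  have cF : Continuous F := continuous_const.add
    (intervalIntegral.continuous_primitive (fun _ _ => hf.intervalIntegrable) 0)
  have cG : Continuous G := continuous_const.add
    (intervalIntegral.continuous_primitive (fun _ _ => hg.intervalIntegrable) 0)
  have hi : IntervalIntegrable (fun t => f t * G t + F t * g t) volume 0 1 :=
    (hf.intervalIntegrable.mul_continuousOn cG.continuousOn).add
      (hg.intervalIntegrable.continuousOn_mul cF.continuousOn)
  set k : ℝ → ℂ := fun t => f t * G t + F t * g t with hk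
  have hki : Integrable ((Ioc (0 : ℝ) 1).indicator k) :=
    (integrable_indicator_iff measurableSet_Ioc).2
      ((intervalIntegrable_iff_integrableOn_Ioc_of_le zero_le_one).1 hi)
  have aK := absolutelyContinuous_integral hki
  have hK {y : ℝ} (hy : y ∈ Icc (0 : ℝ) 1) :
      ∫ t in (0 : ℝ)..y, (Ioc (0 : ℝ) 1).indicator k t = ∫ t in (0 : ℝ)..y, k t := by
    rw [intervalIntegral.integral_of_le hy.1, intervalIntegral.integral_of_le hy.1]
    refine setIntegral_congr_fun measurableSet_Ioc fun t ht => ?_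
    exact indicator_of_mem (Ioc_subset_Ioc_right hy.2 ht) k
  obtain ⟨C, hC⟩ := ((aF.smul aG).sub aK).const_of_ae_hasDerivAt_zero (by
    have hne : ∀ᵐ y : ℝ, y ≠ 0 := by simp [ae_iff, measure_singleton]
    filter_upwards [hf.intervalIntegrable.ae_hasDerivAt_integral (a := 0) (b := 1),
      hg.intervalIntegrable.ae_hasDerivAt_integral (a := 0) (b := 1),
      hki.intervalIntegrable.ae_hasDerivAt_integral (a := 0) (b := 1), hne] with y h1 h2 h3 h4 hy
    have d1 := (h1 hy 0 (by simp)).const_add a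
    have d2 := (h2 hy 0 (by simp)).const_add b
    have d3 := h3 hy 0 (by simp)
    rw [uIcc_of_le zero_le_one] at hy
    rw [indicator_of_mem (show y ∈ Ioc (0 : ℝ) 1 from ⟨lt_of_le_of_ne hy.1 h4.symm, hy.2⟩)] at d3
    convert! (d1.mul d2).sub d3 using 1
    simp [hk, hF, hG])
  rw [uIcc_of_le zero_le_one] at hC
  have e1 := hC x hx
  have e0 := hC 0 (by simp)
  change F x * G x - ∫ t in (0 : ℝ)..x, (Ioc (0 : ℝ) 1).indicator k t = C at e1
  change F 0 * G 0 - ∫ t in (0 : ℝ)..0, (Ioc (0 : ℝ) 1).indicator k t = C at e0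
  rw [hK hx] at e1
  simp only [hF, hG, intervalIntegral.integral_same] at e0
  change F x * G x = a * b + ∫ t in (0 : ℝ)..x, k t
  linear_combination e1 - e0

lemma primitive_eq_indicator (w : ℝ → ℂ) (x : ℝ) :
    primitive w x = ∫ t in (0 : ℝ)..x, (Icc (0 : ℝ) 1).indicator w t := by
  simp only [primitive, intervalIntegral, unitMeasure]
  congr 1 <;>
  · rw [Measure.restrict_restrict measurableSet_Ioc, setIntegral_indicator measurableSet_Icc]

lemma conj_primitive (w : ℝ → ℂ) (x : ℝ) :
    conj (primitive w x) = primitive (fun t => conj (w t)) x := by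
  simp only [primitive, intervalIntegral, map_sub, integral_conj]

lemma primitive_product_rule {f g : ℝ → ℂ} (hf : Integrable f unitMeasure)
    (hg : Integrable g unitMeasure) (a b : ℂ) {x : ℝ} (hx : x ∈ Icc (0 : ℝ) 1) :
    conj (a + primitive f x) * (b + primitive g x) = conj a * b +
      primitive (fun t => conj (f t) * (b + primitive g t) +
        conj (a + primitive f t) * g t) x := by
  have hf' : Integrable ((Icc (0 : ℝ) 1).indicator fun t => conj (f t)) :=
    (integrable_indicator_iff measurableSet_Icc).2
      ((LinearIsometryEquiv.integrable_comp_iff Complex.conjLIE).2 hf)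
  have hg' : Integrable ((Icc (0 : ℝ) 1).indicator g) :=
    (integrable_indicator_iff measurableSet_Icc).2 hg
  have key := integral_product_rule hf' hg' (conj a) b hx
  simp only [map_add, conj_primitive]
  rw [primitive_eq_indicator, primitive_eq_indicator g, key, primitive_eq hx]
  congr 1
  rw [intervalIntegral.integral_of_le hx.1, intervalIntegral.integral_of_le hx.1]
  refine setIntegral_congr_fun measurableSet_Ioc fun t ht => ?_
  have ht' : t ∈ Icc (0 : ℝ) 1 := ⟨ht.1.le, ht.2.trans hx.2⟩
  simp only [primitive_eq_indicator, indicator_of_mem ht']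

lemma primitive_congr {f g : ℝ → ℂ} (h : f =ᵐ[unitMeasure] g) (x : ℝ) :
    primitive f x = primitive g x :=
  intervalIntegral.integral_congr_ae_restrict (ae_restrict_of_ae h)

lemma memLp_bdd_mul {c f : ℝ → ℂ} (hc : Continuous c) {C : ℝ} (hC : ∀ x, ‖c x‖ ≤ C)
    (hf : MemLp f 2 unitMeasure) : MemLp (fun x => c x * f x) 2 unitMeasure :=
  hf.mul (MemLp.of_bound (p := ∞) hc.aestronglyMeasurable C (Filter.Eventually.of_forall hC))

lemma Sob.continuous_eval {n : ℕ} (u : Sob (n + 1)) : Continuous u.eval :=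
  continuous_contRep _ _

lemma Sob.wderiv_zero_ae {n : ℕ} (u : Sob (n + 1)) : u.wderiv 0 =ᵐ[unitMeasure] u.eval :=
  IsPrimitive.ae_eq_contRep (u.2 0)

lemma Sob.memLp_conj_eval_mul {n m : ℕ} (u : Sob (n + 1)) (v : Sob m) (i : Fin (m + 1)) :
    MemLp (fun x => conj (u.eval x) * v.wderiv i x) 2 unitMeasure :=
  memLp_bdd_mul (Complex.continuous_conj.comp u.continuous_eval)
    (fun x => by simpa using u.norm_eval_le x) (Lp.memLp _)

lemma Sob.memLp_conj_wderiv_mul {n m : ℕ} (u : Sob n) (v : Sob (m + 1)) (i : Fin (n + 1)) :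
    MemLp (fun x => conj (u.wderiv i x) * v.eval x) 2 unitMeasure := by
  have : MemLp (fun x => conj (u.wderiv i x)) 2 unitMeasure := (Lp.memLp (u.wderiv i)).star
  simpa only [mul_comm] using memLp_bdd_mul v.continuous_eval v.norm_eval_le this

/-- The function `(conj u) v` in `W_2^1[0,1]`, with weak derivative
`conj (D u) v + (conj u) D v`. -/
def Sob.conjMulOne (u v : Sob 1) : Sob 1 :=
  ⟨WithLp.toLp 2 ![(u.memLp_conj_eval_mul v 0).toLp,
      (u.memLp_conj_wderiv_mul v 1).toLp + (u.memLp_conj_eval_mul v 1).toLp], by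
    intro i
    obtain rfl : i = 0 := Subsingleton.elim _ _
    obtain ⟨a, ha⟩ := u.2 0
    obtain ⟨b, hb⟩ := v.2 0
    refine ⟨conj a * b, ?_⟩
    have hu (x : ℝ) : u.eval x = a + primitive (u.wderiv 1) x := contRep_eq ha x
    have hv (x : ℝ) : v.eval x = b + primitive (v.wderiv 1) x := contRep_eq hb x
    have h1 := (u.memLp_conj_eval_mul v 0).coeFn_toLp
    have h2 : ((u.memLp_conj_wderiv_mul v 1).toLp + (u.memLp_conj_eval_mul v 1).toLp : L2)
        =ᵐ[unitMeasure] fun t => conj (u.wderiv 1 t) * (b + primitive (v.wderiv 1) t) +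
          conj (a + primitive (u.wderiv 1) t) * v.wderiv 1 t := by
      filter_upwards [Lp.coeFn_add (u.memLp_conj_wderiv_mul v 1).toLp
        (u.memLp_conj_eval_mul v 1).toLp, (u.memLp_conj_wderiv_mul v 1).coeFn_toLp,
        (u.memLp_conj_eval_mul v 1).coeFn_toLp] with t e1 e2 e3
      rw [e1, Pi.add_apply, e2, e3, hu, hv]
    filter_upwards [h1, hb, ae_restrict_mem measurableSet_Icc] with x e1 e2 hx
    refine e1.trans ?_
    refine Eq.trans ?_ (congrArg (conj a * b + ·) (primitive_congr h2 x).symm)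
    rw [← primitive_product_rule (L2.integrable _) (L2.integrable _) a b hx, hu]
    exact congrArg (conj (a + primitive (u.wderiv 1) x) * ·) e2⟩

lemma Sob.conjMulOne_zero (u v : Sob 1) :
    (u.conjMulOne v).wderiv 0 =ᵐ[unitMeasure] fun x => conj (u.eval x) * v.eval x := by
  filter_upwards [(u.memLp_conj_eval_mul v 0).coeFn_toLp, v.wderiv_zero_ae] with x h1 h2
  rw [← h2]; exact h1

lemma Sob.conjMulOne_one (u v : Sob 1) :
    (u.conjMulOne v).wderiv 1 =ᵐ[unitMeasure]
      fun x => conj (u.wderiv 1 x) * v.eval x + conj (u.eval x) * v.wderiv 1 x := by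
  filter_upwards [Lp.coeFn_add (u.memLp_conj_wderiv_mul v 1).toLp
        (u.memLp_conj_eval_mul v 1).toLp, (u.memLp_conj_wderiv_mul v 1).coeFn_toLp,
        (u.memLp_conj_eval_mul v 1).coeFn_toLp] with t e1 e2 e3
  rw [← e2, ← e3]; exact e1

lemma Sob.ext_ae {n : ℕ} {u v : Sob n} (h : ∀ i, u.wderiv i =ᵐ[unitMeasure] v.wderiv i) : u = v :=
  Subtype.ext (PiLp.ext fun i => Lp.ext (h i))

lemma Sob.eval_add {n : ℕ} (u v : Sob (n + 1)) (x : ℝ) :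
    (u + v).eval x = u.eval x + v.eval x := contRep_add _ _ _ _ x

lemma Sob.eval_smul {n : ℕ} (c : ℂ) (u : Sob (n + 1)) (x : ℝ) :
    (c • u).eval x = c * u.eval x := contRep_smul _ _ _ x

lemma Sob.wderiv_add {n : ℕ} (u v : Sob n) (i : Fin (n + 1)) :
    (u + v).wderiv i =ᵐ[unitMeasure] fun x => u.wderiv i x + v.wderiv i x := Lp.coeFn_add _ _

lemma Sob.wderiv_smul {n : ℕ} (c : ℂ) (u : Sob n) (i : Fin (n + 1)) :
    (c • u).wderiv i =ᵐ[unitMeasure] fun x => c * u.wderiv i x := Lp.coeFn_smul _ _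

lemma Sob.add_conjMulOne (u u' v : Sob 1) :
    (u + u').conjMulOne v = u.conjMulOne v + u'.conjMulOne v := by
  refine Sob.ext_ae (Fin.forall_fin_two.2 ⟨?_, ?_⟩)
  · filter_upwards [conjMulOne_zero (u + u') v, conjMulOne_zero u v, conjMulOne_zero u' v,
      wderiv_add (u.conjMulOne v) (u'.conjMulOne v) 0] with x h1 h2 h3 h4
    rw [h1, h4, h2, h3, eval_add, map_add]; ring
  · filter_upwards [conjMulOne_one (u + u') v, conjMulOne_one u v, conjMulOne_one u' v,
      wderiv_add (u.conjMulOne v) (u'.conjMulOne v) 1, wderiv_add u u' 1] with x h1 h2 h3 h4 h5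
    rw [h1, h4, h2, h3, h5, eval_add, map_add, map_add]; ring

lemma Sob.conjMulOne_add (u v v' : Sob 1) :
    u.conjMulOne (v + v') = u.conjMulOne v + u.conjMulOne v' := by
  refine Sob.ext_ae (Fin.forall_fin_two.2 ⟨?_, ?_⟩)
  · filter_upwards [conjMulOne_zero u (v + v'), conjMulOne_zero u v, conjMulOne_zero u v',
      wderiv_add (u.conjMulOne v) (u.conjMulOne v') 0] with x h1 h2 h3 h4
    rw [h1, h4, h2, h3, eval_add]; ring
  · filter_upwards [conjMulOne_one u (v + v'), conjMulOne_one u v, conjMulOne_one u v',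
      wderiv_add (u.conjMulOne v) (u.conjMulOne v') 1, wderiv_add v v' 1] with x h1 h2 h3 h4 h5
    rw [h1, h4, h2, h3, h5, eval_add]; ring

lemma Sob.smul_conjMulOne (c : ℂ) (u v : Sob 1) :
    (c • u).conjMulOne v = conj c • u.conjMulOne v := by
  refine Sob.ext_ae (Fin.forall_fin_two.2 ⟨?_, ?_⟩)
  · filter_upwards [conjMulOne_zero (c • u) v, conjMulOne_zero u v,
      wderiv_smul (conj c) (u.conjMulOne v) 0] with x h1 h2 h4
    rw [h1, h4, h2, eval_smul, map_mul]; ring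
  · filter_upwards [conjMulOne_one (c • u) v, conjMulOne_one u v,
      wderiv_smul (conj c) (u.conjMulOne v) 1, wderiv_smul c u 1] with x h1 h2 h4 h5
    rw [h1, h4, h2, h5, eval_smul, map_mul, map_mul]; ring

lemma Sob.conjMulOne_smul (c : ℂ) (u v : Sob 1) :
    u.conjMulOne (c • v) = c • u.conjMulOne v := by
  refine Sob.ext_ae (Fin.forall_fin_two.2 ⟨?_, ?_⟩)
  · filter_upwards [conjMulOne_zero u (c • v), conjMulOne_zero u v,
      wderiv_smul c (u.conjMulOne v) 0] with x h1 h2 h4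
    rw [h1, h4, h2, eval_smul]; ring
  · filter_upwards [conjMulOne_one u (c • v), conjMulOne_one u v,
      wderiv_smul c (u.conjMulOne v) 1, wderiv_smul c v 1] with x h1 h2 h4 h5
    rw [h1, h4, h2, h5, eval_smul]; ring

lemma norm_le_of_ae_conj_mul {c : ℝ → ℂ} {C : ℝ} (hC : ∀ x, ‖c x‖ ≤ C) (w u : L2)
    (h : ∀ᵐ x ∂unitMeasure, ‖u x‖ = ‖c x‖ * ‖w x‖) : ‖u‖ ≤ C * ‖w‖ := by
  refine Lp.norm_le_mul_norm_of_ae_le_mul ?_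
  filter_upwards [h] with x hx
  rw [hx]
  gcongr
  exact hC x

lemma Sob.norm_conjMulOne_le (u v : Sob 1) : ‖u.conjMulOne v‖ ≤ 9 * (‖u‖ * ‖v‖) := by
  have h0 : ‖(u.memLp_conj_eval_mul v 0).toLp‖ ≤ 3 * ‖u‖ * ‖v.wderiv 0‖ := by
    refine norm_le_of_ae_conj_mul u.norm_eval_le _ _ ?_
    filter_upwards [(u.memLp_conj_eval_mul v 0).coeFn_toLp] with x hx
    rw [hx]; simp
  have h1 : ‖(u.memLp_conj_eval_mul v 1).toLp‖ ≤ 3 * ‖u‖ * ‖v.wderiv 1‖ := by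
    refine norm_le_of_ae_conj_mul u.norm_eval_le _ _ ?_
    filter_upwards [(u.memLp_conj_eval_mul v 1).coeFn_toLp] with x hx
    rw [hx]; simp
  have h2 : ‖(u.memLp_conj_wderiv_mul v 1).toLp‖ ≤ 3 * ‖v‖ * ‖u.wderiv 1‖ := by
    refine norm_le_of_ae_conj_mul v.norm_eval_le _ _ ?_
    filter_upwards [(u.memLp_conj_wderiv_mul v 1).coeFn_toLp] with x hx
    rw [hx]; simp [mul_comm]
  have e : ‖u.conjMulOne v‖ ^ 2 = ‖(u.memLp_conj_eval_mul v 0).toLp‖ ^ 2 +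
      ‖(u.memLp_conj_wderiv_mul v 1).toLp + (u.memLp_conj_eval_mul v 1).toLp‖ ^ 2 := by
    change ‖(u.conjMulOne v).1‖ ^ 2 = _
    rw [PiLp.norm_sq_eq_of_L2, Fin.sum_univ_two]
    rfl
  have i0 := u.norm_wderiv_le 1
  have i1 := v.norm_wderiv_le 0
  have i2 := v.norm_wderiv_le 1
  have j0 : ‖(u.memLp_conj_eval_mul v 0).toLp‖ ≤ 3 * (‖u‖ * ‖v‖) := by
    refine h0.trans ?_
    rw [mul_assoc]; gcongr
  have j1 : ‖(u.memLp_conj_wderiv_mul v 1).toLp + (u.memLp_conj_eval_mul v 1).toLp‖ ≤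
      6 * (‖u‖ * ‖v‖) := by
    refine (norm_add_le _ _).trans ((add_le_add h2 h1).trans ?_)
    calc _ ≤ 3 * ‖v‖ * ‖u‖ + 3 * ‖u‖ * ‖v‖ := by gcongr
      _ = _ := by ring
  refine (sq_le_sq₀ (norm_nonneg _) (by positivity)).1 ?_
  rw [e]
  calc _ ≤ (3 * (‖u‖ * ‖v‖)) ^ 2 + (6 * (‖u‖ * ‖v‖)) ^ 2 := by gcongr
    _ ≤ _ := by nlinarith [sq_nonneg (‖u‖ * ‖v‖)]

/-- The inclusion `W_2^{n+1}[0,1] ⊆ W_2^n[0,1]`. -/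
def Sob.lower {n : ℕ} (u : Sob (n + 1)) : Sob n :=
  ⟨WithLp.toLp 2 fun i => u.wderiv i.castSucc, fun i => by
    have := u.2 i.castSucc
    rwa [Fin.succ_castSucc] at this⟩

lemma Sob.norm_lower_le {n : ℕ} (u : Sob (n + 1)) : ‖u.lower‖ ≤ ‖u‖ := by
  have h : ‖u.lower‖ ^ 2 ≤ ‖u‖ ^ 2 := by
    change ‖u.lower.1‖ ^ 2 ≤ ‖u.1‖ ^ 2
    rw [PiLp.norm_sq_eq_of_L2, PiLp.norm_sq_eq_of_L2, Fin.sum_univ_castSucc (n := n + 1)]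
    exact le_add_of_nonneg_right (sq_nonneg _)
  exact (sq_le_sq₀ (norm_nonneg _) (norm_nonneg _)).1 h

/-- The weak derivative of `(conj u) v`, as an element of `W_2^1[0,1]`, for `u, v` in `W_2^2[0,1]`. -/
def Sob.conjMulDeriv (u v : Sob 2) : Sob 1 :=
  u.derivative.conjMulOne v.lower + u.lower.conjMulOne v.derivative

lemma Sob.conjMulDeriv_zero (u v : Sob 2) :
    (u.conjMulDeriv v).wderiv 0 = (u.lower.conjMulOne v.lower).wderiv 1 := by
  refine Lp.ext ?_
  filter_upwards [wderiv_add (u.derivative.conjMulOne v.lower) (u.lower.conjMulOne v.derivative) 0,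
    conjMulOne_zero u.derivative v.lower, conjMulOne_zero u.lower v.derivative,
    conjMulOne_one u.lower v.lower, u.derivative.wderiv_zero_ae, v.derivative.wderiv_zero_ae]
    with x h1 h2 h3 h4 h5 h6
  rw [h4]
  refine h1.trans ?_
  rw [h2, h3, ← h5, ← h6]
  rfl

/-- The function `(conj u) v` in `W_2^2[0,1]`. -/
def Sob.conjMulTwo (u v : Sob 2) : Sob 2 :=
  ⟨WithLp.toLp 2 ![(u.lower.conjMulOne v.lower).wderiv 0, (u.conjMulDeriv v).wderiv 0,
      (u.conjMulDeriv v).wderiv 1],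
    Fin.forall_fin_two.2 ⟨by
      have h := (u.lower.conjMulOne v.lower).2 0
      change IsPrimitive ((u.lower.conjMulOne v.lower).wderiv 0) ((u.conjMulDeriv v).wderiv 0)
      rw [conjMulDeriv_zero]
      exact h, (u.conjMulDeriv v).2 0⟩⟩

lemma Sob.conjMulTwo_zero (u v : Sob 2) :
    (u.conjMulTwo v).wderiv 0 =ᵐ[unitMeasure] fun x => conj (u.eval x) * v.eval x :=
  conjMulOne_zero u.lower v.lower

lemma Sob.lower_add {n : ℕ} (u v : Sob (n + 1)) : (u + v).lower = u.lower + v.lower := rfl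

lemma Sob.lower_smul {n : ℕ} (c : ℂ) (u : Sob (n + 1)) : (c • u).lower = c • u.lower := rfl

lemma Sob.derivative_add {n : ℕ} (u v : Sob (n + 1)) :
    (u + v).derivative = u.derivative + v.derivative := rfl

lemma Sob.derivative_smul {n : ℕ} (c : ℂ) (u : Sob (n + 1)) :
    (c • u).derivative = c • u.derivative := rfl

lemma Sob.ext_two {u v : Sob 2} (h0 : u.lower = v.lower) (h1 : u.derivative = v.derivative) :
    u = v := by
  have e0 (i : Fin 2) : u.wderiv i.castSucc = v.wderiv i.castSucc :=
    congrArg (fun w : Sob 1 => w.wderiv i) h0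
  have e1 (i : Fin 2) : u.wderiv i.succ = v.wderiv i.succ :=
    congrArg (fun w : Sob 1 => w.wderiv i) h1
  refine Subtype.ext (PiLp.ext fun i => ?_)
  exact Fin.cases (e0 0) e1 i

lemma Sob.lower_conjMulTwo (u v : Sob 2) :
    (u.conjMulTwo v).lower = u.lower.conjMulOne v.lower := by
  refine Subtype.ext (PiLp.ext (Fin.forall_fin_two.2 ⟨rfl, conjMulDeriv_zero u v⟩))

lemma Sob.derivative_conjMulTwo (u v : Sob 2) :
    (u.conjMulTwo v).derivative = u.conjMulDeriv v := by
  refine Subtype.ext (PiLp.ext (Fin.forall_fin_two.2 ⟨rfl, rfl⟩))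

lemma Sob.add_conjMulTwo (u u' v : Sob 2) :
    (u + u').conjMulTwo v = u.conjMulTwo v + u'.conjMulTwo v := by
  refine ext_two ?_ ?_
  · simp only [lower_add, lower_conjMulTwo, add_conjMulOne]
  · simp only [derivative_add, lower_add, derivative_conjMulTwo, conjMulDeriv, add_conjMulOne]
    abel

lemma Sob.conjMulTwo_add (u v v' : Sob 2) :
    u.conjMulTwo (v + v') = u.conjMulTwo v + u.conjMulTwo v' := by
  refine ext_two ?_ ?_
  · simp only [lower_add, lower_conjMulTwo, conjMulOne_add]
  · simp only [derivative_add, lower_add, derivative_conjMulTwo, conjMulDeriv, conjMulOne_add]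
    abel

lemma Sob.smul_conjMulTwo (c : ℂ) (u v : Sob 2) :
    (c • u).conjMulTwo v = conj c • u.conjMulTwo v := by
  refine ext_two ?_ ?_
  · simp only [lower_smul, lower_conjMulTwo, smul_conjMulOne]
  · simp only [derivative_smul, lower_smul, derivative_conjMulTwo, conjMulDeriv, smul_conjMulOne,
      smul_add]

lemma Sob.conjMulTwo_smul (c : ℂ) (u v : Sob 2) :
    u.conjMulTwo (c • v) = c • u.conjMulTwo v := by
  refine ext_two ?_ ?_
  · simp only [lower_smul, lower_conjMulTwo, conjMulOne_smul]
  · simp only [derivative_smul, lower_smul, derivative_conjMulTwo, conjMulDeriv, conjMulOne_smul,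
      smul_add]

lemma Sob.norm_conjMulTwo_le (u v : Sob 2) : ‖u.conjMulTwo v‖ ≤ 27 * (‖u‖ * ‖v‖) := by
  have hl : ‖u.lower.conjMulOne v.lower‖ ≤ 9 * (‖u‖ * ‖v‖) :=
    (norm_conjMulOne_le _ _).trans (by gcongr <;> exact norm_lower_le _)
  have hd : ‖u.conjMulDeriv v‖ ≤ 18 * (‖u‖ * ‖v‖) := by
    have h1 : ‖u.derivative.conjMulOne v.lower‖ ≤ 9 * (‖u‖ * ‖v‖) :=
      (norm_conjMulOne_le _ _).trans
        (by gcongr; exacts [norm_derivative_le _, norm_lower_le _])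
    have h2 : ‖u.lower.conjMulOne v.derivative‖ ≤ 9 * (‖u‖ * ‖v‖) :=
      (norm_conjMulOne_le _ _).trans
        (by gcongr; exacts [norm_lower_le _, norm_derivative_le _])
    exact (norm_add_le _ _).trans (by linarith)
  have h0 := ((u.lower.conjMulOne v.lower).norm_wderiv_le 0).trans hl
  have h1 := ((u.conjMulDeriv v).norm_wderiv_le 0).trans hd
  have h2 := ((u.conjMulDeriv v).norm_wderiv_le 1).trans hd
  have e : ‖u.conjMulTwo v‖ ^ 2 = ‖(u.lower.conjMulOne v.lower).wderiv 0‖ ^ 2 +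
      ‖(u.conjMulDeriv v).wderiv 0‖ ^ 2 + ‖(u.conjMulDeriv v).wderiv 1‖ ^ 2 := by
    change ‖(u.conjMulTwo v).1‖ ^ 2 = _
    rw [PiLp.norm_sq_eq_of_L2, Fin.sum_univ_three]
    rfl
  refine (sq_le_sq₀ (norm_nonneg _) (by positivity)).1 ?_
  rw [e]
  calc _ ≤ (9 * (‖u‖ * ‖v‖)) ^ 2 + (18 * (‖u‖ * ‖v‖)) ^ 2 + (18 * (‖u‖ * ‖v‖)) ^ 2 := by gcongr
    _ = _ := by ring

/-! ### The operator -/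

/-- The real space `L_∞[0,1]`. -/
abbrev LInf : Type := Lp ℝ ∞ unitMeasure

/-- The sesquilinear form
`∫ p D²y conj(D²z) dx + ⟨q, conj(D y) D z⟩ + ⟨h, conj(y) z⟩` on `W_2^2[0,1]`. -/
def formValue (p : LInf) (q : SobDual 1) (h : SobDual 2) (y z : Sob 2) : ℂ :=
  (∫ x, (p x : ℂ) * y.wderiv 2 x * conj (z.wderiv 2 x) ∂unitMeasure) +
    q (y.derivative.conjMulOne z.derivative) + h (y.conjMulTwo z)

lemma integral_eq_inner (p : LInf) (v w : L2) :
    ∫ x, (p x : ℂ) * v x * conj (w x) ∂unitMeasure = ⟪w, (p • v : L2)⟫_ℂ := by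
  rw [L2.inner_def]
  refine integral_congr_ae ?_
  filter_upwards [Lp.coeFn_lpSMul (r := 2) p v] with x hx
  rw [hx]
  simp

lemma smul_smul_comm (p : LInf) (c : ℂ) (w : L2) :
    (p • (c • w : L2) : L2) = c • (p • w : L2) := by
  refine Lp.ext ?_
  filter_upwards [Lp.coeFn_lpSMul (r := 2) p (c • w), Lp.coeFn_lpSMul (r := 2) p w,
    Lp.coeFn_smul c w, Lp.coeFn_smul c (p • w : L2)] with x h1 h2 h3 h4
  rw [h1, h4, Pi.smul_apply', Pi.smul_apply, h2, h3, Pi.smul_apply', Pi.smul_apply, smul_comm]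

/-- The bounded operator `L : W_2^2[0,1] → W_2^{-2}[0,1]` with `⟨L y, z⟩ = formValue p q h y z`. -/
def diffOperator (p : LInf) (q : SobDual 1) (h : SobDual 2) : Sob 2 →L[ℂ] SobDual 2 :=
  LinearMap.mkContinuous₂
    (LinearMap.mk₂'ₛₗ (RingHom.id ℂ) (starRingEnd ℂ) (formValue p q h)
      (fun y y' z => by
        have : (y + y').wderiv 2 = y.wderiv 2 + y'.wderiv 2 := rfl
        simp only [formValue, integral_eq_inner, Sob.derivative_add, Sob.add_conjMulOne,
          Sob.add_conjMulTwo, map_add, this, Lp.add_smul, inner_add_right]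
        ring)
      (fun c y z => by
        have : (c • y).wderiv 2 = c • y.wderiv 2 := rfl
        have hs : (p • (c • y.wderiv 2 : L2) : L2) = c • (p • y.wderiv 2 : L2) :=
          smul_smul_comm p c _
        simp only [formValue, integral_eq_inner, Sob.derivative_smul, Sob.smul_conjMulOne,
          Sob.smul_conjMulTwo, map_smulₛₗ, this, hs, inner_smul_right]
        simp
        ring)
      (fun y z z' => by
        have : (z + z').wderiv 2 = z.wderiv 2 + z'.wderiv 2 := rfl
        simp only [formValue, integral_eq_inner, Sob.derivative_add, Sob.conjMulOne_add,
          Sob.conjMulTwo_add, map_add, this, inner_add_left]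
        ring)
      (fun c y z => by
        have : (c • z).wderiv 2 = c • z.wderiv 2 := rfl
        simp only [formValue, integral_eq_inner, Sob.derivative_smul, Sob.conjMulOne_smul,
          Sob.conjMulTwo_smul, map_smulₛₗ, this, inner_smul_left]
        simp
        ring))
    (‖p‖ + 9 * ‖q‖ + 27 * ‖h‖)
    (fun y z => by
      have h1 : ‖⟪z.wderiv 2, (p • y.wderiv 2 : L2)⟫_ℂ‖ ≤ ‖p‖ * (‖y‖ * ‖z‖) := by
        refine (norm_inner_le_norm _ _).trans ?_
        calc _ ≤ ‖z‖ * (‖p‖ * ‖y‖) := by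
              gcongr
              · exact z.norm_wderiv_le 2
              · exact (Lp.norm_smul_le _ _).trans (by gcongr; exact y.norm_wderiv_le 2)
          _ = _ := by ring
      have h2 : ‖q (y.derivative.conjMulOne z.derivative)‖ ≤ ‖q‖ * (9 * (‖y‖ * ‖z‖)) := by
        refine (q.le_opNorm _).trans ?_
        gcongr
        refine (Sob.norm_conjMulOne_le _ _).trans ?_
        gcongr <;> exact Sob.norm_derivative_le _
      have h3 : ‖h (y.conjMulTwo z)‖ ≤ ‖h‖ * (27 * (‖y‖ * ‖z‖)) := by
        refine (h.le_opNorm _).trans ?_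
        gcongr
        exact Sob.norm_conjMulTwo_le _ _
      change ‖formValue p q h y z‖ ≤ _
      rw [formValue, integral_eq_inner]
      refine (norm_add₃_le).trans ?_
      linarith)

lemma diffOperator_apply (p : LInf) (q : SobDual 1) (h : SobDual 2) (y z : Sob 2) :
    diffOperator p q h y z = formValue p q h y z := rfl

/-- `p` is bounded below on `[0,1]` by a positive constant. -/
def IsUniformlyPositive (p : LInf) : Prop := ∃ c > 0, ∀ᵐ x ∂unitMeasure, c ≤ p x

/-- `u` is real-valued on `[0,1]`. -/
def Sob.IsReal {n : ℕ} (u : Sob (n + 1)) : Prop := ∀ x ∈ Icc (0 : ℝ) 1, (u.eval x).im = 0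

/-- The distribution `f` takes real values on real-valued test functions. -/
def SobDual.IsReal {n : ℕ} (f : SobDual (n + 1)) : Prop :=
  ∀ u : Sob (n + 1), u.IsReal → (f u).im = 0

/-- `⟨L y, y⟩ > 0` for all `y ≠ 0`. For the operators `diffOperator p q h` with `p` uniformly
positive and `q`, `h` real, `⟨L y, y⟩` is real, and the condition is equivalent to
`⟨L y, y⟩ ≥ c ‖y‖²` with some constant `c > 0`. -/
def IsPositiveDefinite (L : Sob 2 →L[ℂ] SobDual 2) : Prop := ∀ y : Sob 2, y ≠ 0 → 0 < (L y y).re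

/-- The Green function `G(t,s) = conj ⟨δ_t, L⁻¹ δ_s⟩`. -/
def greenFunction (L : Sob 2 →L[ℂ] SobDual 2) (t s : ℝ) : ℂ :=
  conj (delta t (L.inverse (delta s)))

/-! ### Sign changes -/

/-- There are points `ξ_0 < ⋯ < ξ_n` of `[0,1]` with `g(ξ_k) g(ξ_{k+1}) < 0` for all `k < n`. -/
def Alternates (g : ℝ → ℝ) (n : ℕ) : Prop :=
  ∃ ξ : Fin (n + 1) → ℝ, StrictMono ξ ∧ (∀ k, ξ k ∈ Icc (0 : ℝ) 1) ∧
    ∀ k : Fin n, g (ξ k.castSucc) * g (ξ k.succ) < 0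

/-- The number of sign changes on `[0,1]` of a real function. -/
def signChanges (g : ℝ → ℝ) : ℕ∞ := ⨆ (n : ℕ) (_ : Alternates g n), (n : ℕ∞)

/-- `f` is the functional `z ↦ ∫ g conj(z) dx` of a continuous real function `g` with at most `n`
sign changes. -/
def IsContinuousWithSignChangesLE (f : SobDual 2) (n : ℕ) : Prop :=
  ∃ g : ℝ → ℝ, ContinuousOn g (Icc 0 1) ∧ signChanges g ≤ n ∧
    ∀ z : Sob 2, f z = ∫ x, (g x : ℂ) * conj (z.eval x) ∂unitMeasure

/-- The distribution `f` has at most `n` sign changes: it is a limit in the norm of `W_2^{-2}[0,1]`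
of continuous functions with at most `n` sign changes. -/
def SobDual.SignChangesLE (f : SobDual 2) (n : ℕ) : Prop :=
  f ∈ closure {f' : SobDual 2 | IsContinuousWithSignChangesLE f' n}

/-- The number of sign changes of a distribution (`⊤` if it is not finite). -/
def SobDual.signChanges (f : SobDual 2) : ℕ∞ := ⨅ (n : ℕ) (_ : f.SignChangesLE n), (n : ℕ∞)

end SobolevInterval

end

open SobolevInterval

noncomputable section
namespace SobolevInterval

/-! ### Uniqueness of weak derivatives -/

/-! Let `u` be the solution of `L u = δ_0`, that is, the column `G(·,0)` of the Green function; it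
is positive on `[0,1]`, so a real `y` can be written as `u v` with `v` in `W_2^2`
(`Sob.exists_eq_conjMulTwo`). For real functions the difference `⟨L(uv), uz⟩ - ⟨Lu, uvz⟩` involves
only products of derivatives of `v` with derivatives of `z`, hence equals `B(v', z')` for a local
form `B` on `W_2^1`. If `z(0) = 0`, the subtracted term is `(u²vz)(0) = 0`, so `⟨L(uv), uz⟩ = B(v',
z')`, and `B` inherits positivity from `L`. The fourth order problem is thereby reduced to a second
order, Sturm–Liouville type problem for `v'`.

Suppose first that `L y` is a continuous function `g`. Put `F = g u` and `φ(x) = ∫_x^1 F`.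
Integration by parts gives `B(v', z') = ∫ φ z'` whenever `z(0) = 0`. Taking for `z'` the restriction
of `v'` to one of its nodal intervals, locality and positivity give `∫ φ z' = B(z', z') > 0`, so `φ
v' > 0` somewhere in that interval (`diffOperator_nodal_pos`). Hence `φ` alternates at least as
often as `v'` (`AlternatesFrom.of_nodal`).

It remains to count. Passing from `v` to `v'` may cost one alternation, but the symmetry of `L`
gives `φ(0) = ⟨Ly, u⟩ = ⟨Lu, y⟩ = y(0)`, and this boundary value restores it. Passing from `φ` to `F
= -φ'` costs nothing because `φ(1) = 0`. Dividing by positive `u` leads from `F` back to `g`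
(`AlternatesFrom.of_diffOperator`).

For general `y`, an alternation of `y` consists of finitely many strict inequalities between point
values, so it survives when `L y` is replaced by a close continuous function with few sign changes
and `y` by the corresponding solution. -/

lemma eqOn_of_ae_eq_unitMeasure {f g : ℝ → ℂ} (h : f =ᵐ[unitMeasure] g)
    (hf : ContinuousOn f (Icc 0 1)) (hg : ContinuousOn g (Icc 0 1)) : EqOn f g (Icc 0 1) :=
  Measure.eqOn_Icc_of_ae_eq volume zero_ne_one h hf hg

/-- The two continuous representatives agree on `[0,1]`; differentiating the integrals almost
everywhere (Lebesgue) recovers the derivatives. -/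
lemma IsPrimitive.unique {v w w' : L2} (h : IsPrimitive v w) (h' : IsPrimitive v w') :
    w = w' := by
  obtain ⟨a, ha⟩ := h
  obtain ⟨b, hb⟩ := h'
  have hc (w : L2) (a : ℂ) : Continuous fun x => a + primitive w x :=
    continuous_const.add (continuous_primitive (L2.integrable w))
  have he : EqOn (fun x => a + primitive w x) (fun x => b + primitive w' x) (Icc 0 1) :=
    eqOn_of_ae_eq_unitMeasure (ha.symm.trans hb) (hc w a).continuousOn (hc w' b).continuousOn
  have hi (w : L2) : Integrable ((Icc (0 : ℝ) 1).indicator w) :=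
    (integrable_indicator_iff measurableSet_Icc).2 (L2.integrable w)
  refine Lp.ext ?_
  have hae : ∀ᵐ x : ℝ, x ∈ Ioo (0 : ℝ) 1 → w x = w' x := by
    filter_upwards [(hi w).intervalIntegrable.ae_hasDerivAt_integral (a := 0) (b := 1),
      (hi w').intervalIntegrable.ae_hasDerivAt_integral (a := 0) (b := 1)] with x h1 h2 hx
    have hx' : x ∈ Icc (0 : ℝ) 1 := Ioo_subset_Icc_self hx
    have hxu : x ∈ uIcc (0 : ℝ) 1 := by rwa [uIcc_of_le zero_le_one]
    have d1 := (h1 hxu 0 (by simp)).const_add a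
    have d2 := (h2 hxu 0 (by simp)).const_add b
    rw [indicator_of_mem hx'] at d1 d2
    refine d1.unique (d2.congr_of_eventuallyEq ?_)
    filter_upwards [Icc_mem_nhds hx.1 hx.2] with y hy
    simpa only [primitive_eq_indicator] using he hy
  have := (ae_restrict_iff' (μ := volume) measurableSet_Ioo).2 hae
  rwa [restrict_Ioo_eq_restrict_Icc] at this

lemma Sob.ext_wderiv_zero {n : ℕ} {u v : Sob n} (h : u.wderiv 0 = v.wderiv 0) : u = v := by
  refine Subtype.ext (PiLp.ext fun i => ?_)
  induction i using Fin.induction with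
  | zero => exact h
  | succ i ih => exact (u.2 i).unique (by rw [ih]; exact v.2 i)

/-- Reduces every identity between Sobolev functions below to pointwise algebra, since all weak
derivatives are determined by the function itself. -/
lemma Sob.ext_eval {n : ℕ} {u v : Sob (n + 1)} (h : ∀ x ∈ Icc (0 : ℝ) 1, u.eval x = v.eval x) :
    u = v := by
  refine Sob.ext_wderiv_zero (Lp.ext ?_)
  filter_upwards [u.wderiv_zero_ae, v.wderiv_zero_ae, ae_restrict_mem measurableSet_Icc]
    with x h1 h2 hx
  rw [h1, h2, h x hx]

/-! ### Values of continuous representatives -/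

lemma Sob.eval_sub {n : ℕ} (u v : Sob (n + 1)) (x : ℝ) :
    (u - v).eval x = u.eval x - v.eval x := by
  have h := Sob.eval_add (u - v) v x
  rw [sub_add_cancel] at h
  rw [h]; ring

lemma Sob.eval_eq_of_ae {n : ℕ} {u : Sob (n + 1)} {f : ℝ → ℂ} (h : u.wderiv 0 =ᵐ[unitMeasure] f)
    (hf : ContinuousOn f (Icc 0 1)) {x : ℝ} (hx : x ∈ Icc (0 : ℝ) 1) : u.eval x = f x :=
  eqOn_of_ae_eq_unitMeasure (u.wderiv_zero_ae.symm.trans h) u.continuous_eval.continuousOn hf hx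

lemma Sob.eval_conjMulOne (u v : Sob 1) {x : ℝ} (hx : x ∈ Icc (0 : ℝ) 1) :
    (u.conjMulOne v).eval x = conj (u.eval x) * v.eval x :=
  Sob.eval_eq_of_ae (conjMulOne_zero u v)
    ((Complex.continuous_conj.comp u.continuous_eval).mul v.continuous_eval).continuousOn hx

lemma Sob.eval_conjMulTwo (u v : Sob 2) {x : ℝ} (hx : x ∈ Icc (0 : ℝ) 1) :
    (u.conjMulTwo v).eval x = conj (u.eval x) * v.eval x :=
  Sob.eval_eq_of_ae (conjMulTwo_zero u v)
    ((Complex.continuous_conj.comp u.continuous_eval).mul v.continuous_eval).continuousOn hx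

lemma Sob.eval_derivative_conjMulTwo (u v : Sob 2) {x : ℝ} (hx : x ∈ Icc (0 : ℝ) 1) :
    (u.conjMulTwo v).derivative.eval x =
      conj (u.derivative.eval x) * v.eval x + conj (u.eval x) * v.derivative.eval x := by
  rw [derivative_conjMulTwo, conjMulDeriv, eval_add, eval_conjMulOne _ _ hx,
    eval_conjMulOne _ _ hx]
  rfl

lemma Sob.wderiv_one_ae (u : Sob 2) : u.wderiv 1 =ᵐ[unitMeasure] u.derivative.eval :=
  u.derivative.wderiv_zero_ae

lemma Sob.wderiv_two_conjMulTwo (u v : Sob 2) :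
    (u.conjMulTwo v).wderiv 2 =ᵐ[unitMeasure] fun x => conj (u.wderiv 2 x) * v.eval x +
      2 * (conj (u.derivative.eval x) * v.derivative.eval x) + conj (u.eval x) * v.wderiv 2 x := by
  filter_upwards [wderiv_add (u.derivative.conjMulOne v.lower) (u.lower.conjMulOne v.derivative) 1,
    conjMulOne_one u.derivative v.lower, conjMulOne_one u.lower v.derivative,
    u.wderiv_one_ae, v.wderiv_one_ae] with x h1 h2 h3 h4 h5
  refine Eq.trans h1 ?_
  rw [h2, h3, show u.lower.wderiv 1 x = u.derivative.eval x from h4,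
    show v.lower.wderiv 1 x = v.derivative.eval x from h5]
  change conj (u.wderiv 2 x) * v.eval x + _ + (_ + conj (u.eval x) * v.wderiv 2 x) = _
  ring

/-! ### Fundamental theorem of calculus -/

lemma contRep_apply_eq_add_primitive (v w : L2) (x : ℝ) :
    contRep v w x = contRep v w 0 + primitive w x := by
  simp [contRep, primitive]

lemma Sob.eval_eq_add_primitive {n : ℕ} (u : Sob (n + 1)) (x : ℝ) :
    u.eval x = u.eval 0 + primitive (u.wderiv 1) x := contRep_apply_eq_add_primitive _ _ x

lemma Sob.eval_eq_add_integral (u : Sob 2) {x : ℝ} (hx : x ∈ Icc (0 : ℝ) 1) :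
    u.eval x = u.eval 0 + ∫ t in (0 : ℝ)..x, u.derivative.eval t := by
  rw [u.eval_eq_add_primitive, primitive_congr u.wderiv_one_ae, primitive_eq hx]

lemma Sob.hasDerivAt_eval (u : Sob 2) {x : ℝ} (hx : x ∈ Ioo (0 : ℝ) 1) :
    HasDerivAt u.eval (u.derivative.eval x) x := by
  have h := (intervalIntegral.integral_hasDerivAt_right
    (u.derivative.continuous_eval.intervalIntegrable 0 x)
    u.derivative.continuous_eval.stronglyMeasurable.stronglyMeasurableAtFilter
    u.derivative.continuous_eval.continuousAt).const_add (u.eval 0)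
  refine h.congr_of_eventuallyEq ?_
  filter_upwards [Icc_mem_nhds hx.1 hx.2] with y hy using u.eval_eq_add_integral hy

/-! ### Construction of Sobolev functions -/

lemma memLp_unitMeasure_of_continuousOn {f : ℝ → ℂ} (hf : ContinuousOn f (Icc 0 1)) :
    MemLp f 2 unitMeasure := by
  obtain ⟨C, hC⟩ := isCompact_Icc.exists_bound_of_continuousOn hf
  refine MemLp.of_bound (hf.aestronglyMeasurable measurableSet_Icc) C ?_
  filter_upwards [ae_restrict_mem measurableSet_Icc] with x hx using hC x hx

lemma exists_sob_one {f : ℝ → ℂ} {w : L2}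
    (h : ∀ x ∈ Icc (0 : ℝ) 1, f x = f 0 + primitive w x) :
    ∃ r : Sob 1, (∀ x ∈ Icc (0 : ℝ) 1, r.eval x = f x) ∧ r.wderiv 1 = w := by
  have hf : ContinuousOn f (Icc 0 1) :=
    (continuous_const.add (continuous_primitive (L2.integrable w))).continuousOn.congr h
  have hm := memLp_unitMeasure_of_continuousOn hf
  refine ⟨⟨WithLp.toLp 2 ![hm.toLp, w], fun i => ?_⟩,
    fun x hx => Sob.eval_eq_of_ae hm.coeFn_toLp hf hx, rfl⟩
  obtain rfl : i = 0 := Subsingleton.elim _ _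
  refine ⟨f 0, ?_⟩
  filter_upwards [hm.coeFn_toLp, ae_restrict_mem measurableSet_Icc] with x h1 hx
  exact h1.trans (h x hx)

lemma exists_sob_two {f : ℝ → ℂ} {w : Sob 1}
    (h : ∀ x ∈ Icc (0 : ℝ) 1, f x = f 0 + primitive w.eval x) :
    ∃ r : Sob 2, (∀ x ∈ Icc (0 : ℝ) 1, r.eval x = f x) ∧ r.derivative = w := by
  have h' : ∀ x ∈ Icc (0 : ℝ) 1, f x = f 0 + primitive (w.wderiv 0) x := fun x hx => by
    rw [h x hx, primitive_congr w.wderiv_zero_ae]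
  obtain ⟨r, hr, hw⟩ := exists_sob_one h'
  refine ⟨⟨WithLp.toLp 2 ![r.wderiv 0, w.wderiv 0, w.wderiv 1],
    Fin.forall_fin_two.2 ⟨?_, w.2 0⟩⟩, fun x hx => ?_, ?_⟩
  · change IsPrimitive (r.wderiv 0) (w.wderiv 0)
    rw [← hw]; exact r.2 0
  · rw [← hr x hx]
    change contRep (r.wderiv 0) (w.wderiv 0) x = contRep (r.wderiv 0) (r.wderiv 1) x
    rw [hw]
  · exact Subtype.ext (PiLp.ext (Fin.forall_fin_two.2 ⟨rfl, rfl⟩))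

/-! ### Real functions -/

/-- The complex conjugate of `u`. -/
def Sob.conj {n : ℕ} (u : Sob n) : Sob n :=
  ⟨WithLp.toLp 2 fun i => star (u.wderiv i), fun i => by
    obtain ⟨a, ha⟩ := u.2 i
    refine ⟨starRingEnd ℂ a, ?_⟩
    filter_upwards [ha, Lp.coeFn_star (u.wderiv i.castSucc)] with x h1 h2
    refine h2.trans ?_
    rw [primitive_congr (Lp.coeFn_star (u.wderiv i.succ))]
    change starRingEnd ℂ (u.wderiv i.castSucc x) = _
    rw [show u.wderiv i.castSucc x = _ from h1, map_add, conj_primitive]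
    rfl⟩

lemma Sob.wderiv_conj {n : ℕ} (u : Sob n) (i : Fin (n + 1)) :
    u.conj.wderiv i =ᵐ[unitMeasure] fun x => starRingEnd ℂ (u.wderiv i x) :=
  Lp.coeFn_star (u.wderiv i)

lemma Sob.derivative_conj {n : ℕ} (u : Sob (n + 1)) : u.conj.derivative = u.derivative.conj := rfl

lemma Sob.eval_conj {n : ℕ} (u : Sob (n + 1)) {x : ℝ} (hx : x ∈ Icc (0 : ℝ) 1) :
    u.conj.eval x = starRingEnd ℂ (u.eval x) := by
  refine Sob.eval_eq_of_ae (f := fun x => starRingEnd ℂ (u.eval x)) ?_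
    (Complex.continuous_conj.comp u.continuous_eval).continuousOn hx
  filter_upwards [u.wderiv_conj 0, u.wderiv_zero_ae] with x h1 h2
  rw [h1, h2]

/-- Conjugation acts on all weak derivatives at once, so this form of reality passes from the values
of `u` to its derivatives. -/
lemma Sob.isReal_iff_conj_eq {n : ℕ} {u : Sob (n + 1)} : u.IsReal ↔ u.conj = u := by
  refine ⟨fun h => Sob.ext_eval fun x hx => ?_, fun h x hx => ?_⟩
  · rw [u.eval_conj hx, Complex.conj_eq_iff_im.2 (h x hx)]
  · rw [← Complex.conj_eq_iff_im, ← u.eval_conj hx, h]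

lemma Sob.IsReal.conj_eval {n : ℕ} {u : Sob (n + 1)} (h : u.IsReal) {x : ℝ}
    (hx : x ∈ Icc (0 : ℝ) 1) : starRingEnd ℂ (u.eval x) = u.eval x :=
  Complex.conj_eq_iff_im.2 (h x hx)

lemma Sob.IsReal.conj_wderiv {n : ℕ} {u : Sob (n + 1)} (h : u.IsReal) (i : Fin (n + 2)) :
    ∀ᵐ x ∂unitMeasure, starRingEnd ℂ (u.wderiv i x) = u.wderiv i x := by
  filter_upwards [u.wderiv_conj i] with x hx
  rw [← hx, Sob.isReal_iff_conj_eq.1 h]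

lemma Sob.IsReal.derivative {n : ℕ} {u : Sob (n + 2)} (h : u.IsReal) : u.derivative.IsReal := by
  rw [Sob.isReal_iff_conj_eq, ← Sob.derivative_conj, Sob.isReal_iff_conj_eq.1 h]

lemma Sob.IsReal.sub {n : ℕ} {u v : Sob (n + 1)} (hu : u.IsReal) (hv : v.IsReal) :
    (u - v).IsReal := fun x hx => by
  rw [Sob.eval_sub, Complex.sub_im, hu x hx, hv x hx, sub_zero]

lemma Sob.IsReal.conjMulOne {u v : Sob 1} (hu : u.IsReal) (hv : v.IsReal) :
    (u.conjMulOne v).IsReal := fun x hx => by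
  rw [Sob.eval_conjMulOne _ _ hx, Complex.mul_im, Complex.conj_im, hu x hx, hv x hx]; simp

lemma Sob.IsReal.conjMulTwo {u v : Sob 2} (hu : u.IsReal) (hv : v.IsReal) :
    (u.conjMulTwo v).IsReal := fun x hx => by
  rw [Sob.eval_conjMulTwo _ _ hx, Complex.mul_im, Complex.conj_im, hu x hx, hv x hx]; simp

lemma Sob.exists_re_add_I_smul_im {n : ℕ} (u : Sob (n + 1)) :
    ∃ a b : Sob (n + 1), a.IsReal ∧ b.IsReal ∧ u = a + Complex.I • b ∧
      ∀ x ∈ Icc (0 : ℝ) 1, (a.eval x).re = (u.eval x).re := by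
  have ha : ∀ x ∈ Icc (0 : ℝ) 1, ((2⁻¹ : ℂ) • (u + u.conj)).eval x = ((u.eval x).re : ℂ) := by
    intro x hx
    rw [eval_smul, eval_add, eval_conj _ hx, Complex.add_conj]
    push_cast; ring
  have hb : ∀ x ∈ Icc (0 : ℝ) 1, ((-Complex.I * 2⁻¹) • (u - u.conj)).eval x =
      ((u.eval x).im : ℂ) := by
    intro x hx
    rw [eval_smul, eval_sub, eval_conj _ hx, Complex.sub_conj]
    push_cast
    linear_combination (-((u.eval x).im : ℂ)) * Complex.I_mul_I
  refine ⟨(2⁻¹ : ℂ) • (u + u.conj), (-Complex.I * 2⁻¹) • (u - u.conj), fun x hx => ?_,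
    fun x hx => ?_, Sob.ext_eval fun x hx => ?_, fun x hx => ?_⟩
  · rw [ha x hx, Complex.ofReal_im]
  · rw [hb x hx, Complex.ofReal_im]
  · rw [eval_add, ha x hx, eval_smul, hb x hx, mul_comm, Complex.re_add_im]
  · rw [ha x hx, Complex.ofReal_re]

/-! ### Alternation patterns -/

/-- `g` alternates `n` times on `[0,1]`, the first value having the sign of `s`. -/
def AlternatesFrom (g : ℝ → ℝ) (s : ℝ) (n : ℕ) : Prop :=
  ∃ ξ : ℕ → ℝ, (∀ k < n, ξ k < ξ (k + 1)) ∧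
    ∀ k ≤ n, ξ k ∈ Icc (0 : ℝ) 1 ∧ 0 < s * (-1) ^ k * g (ξ k)

lemma AlternatesFrom.alternates {g : ℝ → ℝ} {s : ℝ} {n : ℕ} (h : AlternatesFrom g s n) :
    Alternates g n := by
  obtain ⟨ξ, hlt, hξ⟩ := h
  refine ⟨fun k => ξ k, Fin.strictMono_iff_lt_succ.2 fun k => hlt k k.2,
    fun k => (hξ k (Nat.lt_succ_iff.1 k.2)).1, fun k => ?_⟩
  have h1 := (hξ k k.2.le).2
  have h2 := (hξ (k + 1) k.2).2
  have h3 := mul_pos h1 h2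
  have e : s * (-1) ^ (k : ℕ) * g (ξ k) * (s * (-1) ^ ((k : ℕ) + 1) * g (ξ (k + 1))) =
      -(s ^ 2 * ((-1) ^ (k : ℕ)) ^ 2 * (g (ξ k) * g (ξ (k + 1)))) := by ring
  rw [e, ← pow_mul, mul_comm (k : ℕ) 2, pow_mul] at h3
  norm_num at h3
  simp only [Fin.val_castSucc, Fin.val_succ]
  by_contra! h4
  nlinarith [mul_nonneg (sq_nonneg s) h4]

/-- The first value itself serves as `s`. It is nonzero only because `n > 0`: for `n = 0` an
alternation carries no sign. -/
lemma Alternates.exists_alternatesFrom {g : ℝ → ℝ} {n : ℕ} (hn : 0 < n) (h : Alternates g n) :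
    ∃ s : ℝ, AlternatesFrom g s n := by
  obtain ⟨ξ, hm, hI, hξ⟩ := h
  -- The value 0 beyond index `n` is never inspected.
  set η : ℕ → ℝ := fun k => if hk : k < n + 1 then ξ ⟨k, hk⟩ else 0 with hη
  have e (k : ℕ) (hk : k < n + 1) : η k = ξ ⟨k, hk⟩ := dif_pos hk
  have hneg (k : ℕ) (hk : k < n) : g (η k) * g (η (k + 1)) < 0 := by
    rw [e k (by omega), e (k + 1) (by omega)]
    exact hξ ⟨k, hk⟩
  refine ⟨g (η 0), η, fun k hk => ?_, fun k hk => ⟨?_, ?_⟩⟩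
  · rw [e k (by omega), e (k + 1) (by omega)]
    exact hm (by simp [Fin.lt_def])
  · rw [e k (by omega)]; exact hI _
  · induction k with
    | zero =>
      have := hneg 0 hn
      have h0 : g (η 0) ≠ 0 := fun h => by simp [h] at this
      have := mul_self_pos.2 h0
      simpa using this
    | succ k ih =>
      have h1 := ih (by omega)
      have h2 := hneg k (by omega)
      have h3 : 0 < -(g (η k) * g (η (k + 1))) * (g (η 0) * (-1) ^ k * g (η k)) :=
        mul_pos (neg_pos.2 h2) h1
      have h4 : 0 < g (η k) ^ 2 := by
        have : g (η k) ≠ 0 := fun h => by simp [h] at h2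
        positivity
      have e2 : -(g (η k) * g (η (k + 1))) * (g (η 0) * (-1) ^ k * g (η k)) =
          g (η k) ^ 2 * (g (η 0) * (-1) ^ (k + 1) * g (η (k + 1))) := by ring
      rw [e2] at h3
      exact (mul_pos_iff_of_pos_left h4).1 h3

lemma AlternatesFrom.cons {g : ℝ → ℝ} {s : ℝ} {n : ℕ} (h : AlternatesFrom g (-s) n)
    (h0 : 0 < s * g 0) : AlternatesFrom g s (n + 1) := by
  obtain ⟨ξ, hlt, hξ⟩ := h
  -- At `ξ 0` the function has the sign of `-s`, at 0 that of `s`, so the points differ.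
  have hpos : 0 < ξ 0 := by
    obtain ⟨h1, h2⟩ := hξ 0 n.zero_le
    refine lt_of_le_of_ne h1.1 fun h => ?_
    rw [← h] at h2
    simp at h2; linarith
  refine ⟨fun k => Nat.casesOn k 0 ξ, ?_, ?_⟩
  · rintro (_ | k) hk
    · exact hpos
    · exact hlt k (by omega)
  · rintro (_ | k) hk
    · exact ⟨by simp, by simpa using h0⟩
    · refine ⟨(hξ k (by omega)).1, ?_⟩
      have := (hξ k (by omega)).2
      rw [pow_succ]
      convert! this using 1
      ring

/-! ### Rolle-type counting for integrals -/

lemma exists_pos_of_intervalIntegral_pos {g : ℝ → ℝ} {a b : ℝ} (hab : a ≤ b)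
    (h : 0 < ∫ x in a..b, g x) : ∃ x ∈ Ioc a b, 0 < g x := by
  by_contra! hc
  rw [intervalIntegral.integral_of_le hab] at h
  exact h.not_ge (setIntegral_nonpos measurableSet_Ioc hc)

/-- If the increments of an integral of `g` over consecutive intervals alternate in sign, then so
does `g`. -/
lemma alternatesFrom_of_increments {F g : ℝ → ℝ} {s : ℝ} {n : ℕ} {ξ : ℕ → ℝ}
    (hlt : ∀ k ≤ n, ξ k ≤ ξ (k + 1)) (hξ : ∀ k ≤ n + 1, ξ k ∈ Icc (0 : ℝ) 1)
    (hF : ∀ a ∈ Icc (0 : ℝ) 1, ∀ b ∈ Icc (0 : ℝ) 1, a ≤ b → F b - F a = ∫ x in a..b, g x)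
    (hs : ∀ k ≤ n, 0 < s * (-1) ^ k * (F (ξ (k + 1)) - F (ξ k))) :
    AlternatesFrom g s n := by
  have hex : ∀ k, ∃ x, k ≤ n → x ∈ Ioc (ξ k) (ξ (k + 1)) ∧ 0 < s * (-1) ^ k * g x := by
    intro k
    by_cases hk : k ≤ n
    · have h := hs k hk
      rw [hF _ (hξ k (by omega)) _ (hξ (k + 1) (by omega)) (hlt k hk),
        ← intervalIntegral.integral_const_mul] at h
      obtain ⟨x, hx, hx'⟩ := exists_pos_of_intervalIntegral_pos (hlt k hk) h
      exact ⟨x, fun _ => ⟨hx, hx'⟩⟩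
    · exact ⟨0, fun h => absurd h hk⟩
  choose η hη using hex
  refine ⟨η, fun k hk => ?_, fun k hk => ⟨⟨?_, ?_⟩, (hη k hk).2⟩⟩
  -- The half-open intervals `(ξ k, ξ (k+1)]` are disjoint, which makes the chosen points strictly
  -- increasing.
  · exact (hη k hk.le).1.2.trans_lt (hη (k + 1) hk).1.1
  · exact (hξ k (by omega)).1.trans (hη k hk).1.1.le
  · exact (hη k hk).1.2.trans (hξ (k + 1) (by omega)).2

/-- Without boundary information one alternation is lost, and the sign is reversed: `F` first moves
away from the sign of `s`. -/
lemma AlternatesFrom.of_integral {F g : ℝ → ℝ} {s : ℝ} {n : ℕ} (h : AlternatesFrom F s (n + 1))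
    (hF : ∀ a ∈ Icc (0 : ℝ) 1, ∀ b ∈ Icc (0 : ℝ) 1, a ≤ b → F b - F a = ∫ x in a..b, g x) :
    AlternatesFrom g (-s) n := by
  obtain ⟨ξ, hlt, hξ⟩ := h
  refine alternatesFrom_of_increments (fun k hk => (hlt k (by omega)).le)
    (fun k hk => (hξ k hk).1) hF fun k hk => ?_
  have h1 := (hξ k (by omega)).2
  have h2 := (hξ (k + 1) (by omega)).2
  rw [pow_succ] at h2
  linarith

/-- The increment from 0 to the first alternation point has the sign of `s` and makes up for the
lost alternation. -/
lemma AlternatesFrom.of_integral_of_nonpos {F g : ℝ → ℝ} {s : ℝ} {n : ℕ}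
    (h : AlternatesFrom F s n) (h0 : s * F 0 ≤ 0)
    (hF : ∀ a ∈ Icc (0 : ℝ) 1, ∀ b ∈ Icc (0 : ℝ) 1, a ≤ b → F b - F a = ∫ x in a..b, g x) :
    AlternatesFrom g s n := by
  obtain ⟨ξ, hlt, hξ⟩ := h
  refine alternatesFrom_of_increments (ξ := fun k => Nat.casesOn k 0 ξ) ?_ ?_ hF ?_
  · rintro (_ | k) hk
    · exact (hξ 0 hk).1.1
    · exact (hlt k (by omega)).le
  · rintro (_ | k) hk
    · simp
    · exact (hξ k (by omega)).1
  · rintro (_ | k) hk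
    · have := (hξ 0 hk).2
      simp only [pow_zero, mul_one] at this ⊢
      change 0 < s * (F (ξ 0) - F 0)
      linarith
    · have h1 := (hξ k (by omega)).2
      have h2 := (hξ (k + 1) (by omega)).2
      rw [pow_succ] at h2 ⊢
      simp only
      linarith

/-- The return from the last alternation point to the value 0 at 1 supplies the additional
increment. -/
lemma AlternatesFrom.of_integral_of_last {F g : ℝ → ℝ} {s : ℝ} {n : ℕ}
    (h : AlternatesFrom F s n) (h1 : F 1 = 0)
    (hF : ∀ a ∈ Icc (0 : ℝ) 1, ∀ b ∈ Icc (0 : ℝ) 1, a ≤ b → F b - F a = ∫ x in a..b, g x) :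
    AlternatesFrom g (-s) n := by
  obtain ⟨ξ, hlt, hξ⟩ := h
  refine alternatesFrom_of_increments (ξ := fun k => if k ≤ n then ξ k else 1) ?_ ?_ hF ?_
  · intro k hk
    by_cases hk' : k + 1 ≤ n
    · simpa [hk, hk'] using (hlt k hk').le
    · simpa [hk, hk'] using (hξ k hk).1.2
  · intro k hk
    by_cases hk' : k ≤ n
    · simpa [hk'] using (hξ k hk').1
    · simp [hk']
  · intro k hk
    have h2 := (hξ k hk).2
    by_cases hk' : k + 1 ≤ n
    · have h3 := (hξ (k + 1) hk').2
      rw [pow_succ] at h3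
      simp only [hk, hk', if_true]
      linarith
    · simp only [hk, hk', if_true, if_false, h1]
      linarith

lemma AlternatesFrom.of_mul_pos {f g u : ℝ → ℝ} {s : ℝ} {n : ℕ} (h : AlternatesFrom f s n)
    (hu : ∀ x ∈ Icc (0 : ℝ) 1, 0 < u x) (hf : ∀ x ∈ Icc (0 : ℝ) 1, f x = g x * u x) :
    AlternatesFrom g s n := by
  obtain ⟨ξ, hlt, hξ⟩ := h
  refine ⟨ξ, hlt, fun k hk => ⟨(hξ k hk).1, ?_⟩⟩
  have h1 := (hξ k hk).2
  rw [hf _ (hξ k hk).1, ← mul_assoc] at h1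
  exact (mul_pos_iff_of_pos_right (hu _ (hξ k hk).1)).1 h1

/-! ### Nodal intervals -/

/-- The maximal subinterval of `[0,1]` around `η` on the interior of which `w` keeps its sign. -/
lemma exists_nodal_interval {w : ℝ → ℝ} (hw : Continuous w) {η : ℝ} (hη : η ∈ Icc (0 : ℝ) 1)
    {s : ℝ} (hs : 0 < s * w η) :
    ∃ a b, 0 ≤ a ∧ a ≤ η ∧ η ≤ b ∧ b ≤ 1 ∧ (a = 0 ∨ w a = 0) ∧ (b = 1 ∨ w b = 0) ∧
      (∀ x ∈ Ioo a b, 0 < s * w x) ∧ ∀ x ∈ Icc a b, 0 ≤ s * w x := by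
  have hws : Continuous fun x => s * w x := continuous_const.mul hw
  have hs0 : s ≠ 0 := fun h => by simp [h] at hs
  have hcl : IsClosed {x | w x = 0} := isClosed_eq hw continuous_const
  obtain ⟨a, ha, hamax⟩ := ((isCompact_Icc (a := (0 : ℝ)) (b := η)).inter_right
    ((isClosed_singleton (x := (0 : ℝ))).union hcl)).exists_isGreatest
    ⟨0, ⟨le_rfl, hη.1⟩, Or.inl rfl⟩
  obtain ⟨b, hb, hbmin⟩ := ((isCompact_Icc (a := η) (b := (1 : ℝ))).inter_right
    ((isClosed_singleton (x := (1 : ℝ))).union hcl)).exists_isLeast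
    ⟨1, ⟨hη.2, le_rfl⟩, Or.inl rfl⟩
  have hpos : ∀ x ∈ Ioo a b, 0 < s * w x := by
    intro x hx
    by_contra! hneg
    -- `η` may be 0 or 1 and thus an endpoint of `[a, b]`, so it is listed separately; `w` does not
    -- vanish there.
    have hη0 : ∀ c ∈ uIcc x η, c ∈ Ioo a b ∨ c = η := by
      intro c hc
      by_cases h : c = η
      · exact Or.inr h
      left
      rcases le_total x η with hxη | hxη
      · rw [uIcc_of_le hxη] at hc
        exact ⟨hx.1.trans_le hc.1, (lt_of_le_of_ne hc.2 h).trans_le hb.1.1⟩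
      · rw [uIcc_of_ge hxη] at hc
        exact ⟨ha.1.2.trans_lt (lt_of_le_of_ne hc.1 (Ne.symm h)), hc.2.trans_lt hx.2⟩
    obtain ⟨c, hc, hc0⟩ := intermediate_value_uIcc (a := x) (b := η) hws.continuousOn
      (show (0 : ℝ) ∈ uIcc (s * w x) (s * w η) by
        rw [uIcc_of_le (hneg.trans hs.le)]; exact ⟨hneg, hs.le⟩)
    have hwc : w c = 0 := (mul_eq_zero.1 hc0).resolve_left hs0
    rcases hη0 c hc with hc' | rfl
    · rcases le_total c η with h | h
      · exact hc'.1.not_ge (hamax ⟨⟨ha.1.1.trans hc'.1.le, h⟩, Or.inr hwc⟩)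
      · exact hc'.2.not_ge (hbmin ⟨⟨h, hc'.2.le.trans hb.1.2⟩, Or.inr hwc⟩)
    · simp [hwc] at hs
  refine ⟨a, b, ha.1.1, ha.1.2, hb.1.1, hb.1.2, ha.2, hb.2, hpos, fun x hx => ?_⟩
  rcases eq_or_ne a b with hab | hab
  · have : x = η := le_antisymm (hx.2.trans (hab ▸ ha.1.2)) (hb.1.1.trans (hab ▸ hx.1))
    rw [this]; exact hs.le
  · have hsub : Icc a b ⊆ {x | 0 ≤ s * w x} := by
      rw [← closure_Ioo hab]
      exact closure_minimal (fun x hx => (hpos x hx).le) (isClosed_le continuous_const hws)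
    exact hsub hx

/-- If `φ` agrees in sign with `w` somewhere in every nodal interval of `w`, then it alternates as
often as `w`. -/
lemma AlternatesFrom.of_nodal {w φ : ℝ → ℝ} (hw : Continuous w) {s : ℝ} {n : ℕ}
    (h : AlternatesFrom w s n)
    (hφ : ∀ a b η, 0 ≤ a → a ≤ η → η ≤ b → b ≤ 1 → w η ≠ 0 → (a = 0 ∨ w a = 0) →
      (b = 1 ∨ w b = 0) → ∃ θ ∈ Icc a b, 0 < φ θ * w θ) :
    AlternatesFrom φ s n := by
  obtain ⟨ξ, hlt, hξ⟩ := h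
  have hex : ∀ k, ∃ a b θ, k ≤ n → a ≤ ξ k ∧ ξ k ≤ b ∧ 0 ≤ a ∧ b ≤ 1 ∧
      (∀ x ∈ Ioo a b, 0 < s * (-1) ^ k * w x) ∧ (∀ x ∈ Icc a b, 0 ≤ s * (-1) ^ k * w x) ∧
      θ ∈ Icc a b ∧ 0 < s * (-1) ^ k * φ θ := by
    intro k
    by_cases hk : k ≤ n
    · obtain ⟨a, b, h1, h2, h3, h4, h5, h6, h7, h8⟩ :=
        exists_nodal_interval hw (hξ k hk).1 (hξ k hk).2
      have hne : w (ξ k) ≠ 0 := fun h => by have := (hξ k hk).2; simp [h] at this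
      obtain ⟨θ, hθ, hθ'⟩ := hφ a b _ h1 h2 h3 h4 hne h5 h6
      refine ⟨a, b, θ, fun _ => ⟨h2, h3, h1, h4, h7, h8, hθ, ?_⟩⟩
      have h9 := h8 θ hθ
      have hs : s * (-1) ^ k ≠ 0 := fun h => by have := (hξ k hk).2; simp [h] at this
      have h10 : w θ ≠ 0 := fun h => by simp [h] at hθ'
      have h11 : 0 < s * (-1) ^ k * w θ := lt_of_le_of_ne h9 (mul_ne_zero hs h10).symm
      have h12 : 0 < (w θ) ^ 2 := by positivity
      have h13 : 0 < (s * (-1) ^ k * φ θ) * w θ ^ 2 := by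
        have := mul_pos h11 hθ'
        convert! this using 1; ring
      exact (mul_pos_iff_of_pos_right h12).1 h13
    · exact ⟨0, 0, 0, fun h => absurd h hk⟩
  choose a b θ hab using hex
  refine ⟨θ, fun k hk => ?_, fun k hk => ?_⟩
  · obtain ⟨h1, h2, h3, h4, h5, h6, h7, h8⟩ := hab k hk.le
    obtain ⟨h1', h2', h3', h4', h5', h6', h7', h8'⟩ := hab (k + 1) hk
    -- Consecutive nodal intervals carry opposite signs. If they were out of order their interiors
    -- would meet, and `w` would have both signs at a common point.
    have hba : b k ≤ a (k + 1) := by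
      by_contra! hlt'
      have hm : max (a k) (a (k + 1)) < min (b k) (b (k + 1)) := by
        have hξ' := hlt k hk
        have hbk : ξ k < b k := by
          refine lt_of_le_of_ne h2 fun he => ?_
          have i1 := h6' (ξ k) ⟨(hlt'.trans_eq he.symm).le, hξ'.le.trans h2'⟩
          have i2 := (hξ k hk.le).2
          rw [pow_succ] at i1
          linarith
        have hak : a (k + 1) < ξ (k + 1) := by
          refine lt_of_le_of_ne h1' fun he => ?_
          have i1 := h6 (ξ (k + 1)) ⟨h1.trans hξ'.le, (he.symm.trans_lt hlt').le⟩
          have i2 := (hξ (k + 1) hk).2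
          rw [pow_succ] at i2
          linarith
        exact max_lt (lt_min (h1.trans_lt hbk) (h1.trans_lt (hξ'.trans_le h2')))
          (lt_min hlt' (hak.trans_le h2'))
      obtain ⟨x, hx1, hx2⟩ := exists_between hm
      rw [max_lt_iff] at hx1
      rw [lt_min_iff] at hx2
      have i1 := h5 x ⟨hx1.1, hx2.1⟩
      have i2 := h5' x ⟨hx1.2, hx2.2⟩
      rw [pow_succ] at i2
      linarith
    refine lt_of_le_of_ne (h7.2.trans (hba.trans h7'.1)) fun he => ?_
    rw [← he, pow_succ] at h8'
    linarith
  · obtain ⟨h1, h2, h3, h4, h5, h6, h7, h8⟩ := hab k hk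
    exact ⟨⟨h3.trans h7.1, h7.2.trans h4⟩, h8⟩

/-! ### Multiplication and division by a real function -/

/-- Bootstrapping: the derivative `-u'/u²` is continuous, so `1/u` lies in `W_2^1`; then this
derivative is a product of `W_2^1` functions, which gives one more order. -/
lemma Sob.exists_inv {u : Sob 2} (hu : u.IsReal) (h0 : ∀ x ∈ Icc (0 : ℝ) 1, u.eval x ≠ 0) :
    ∃ r : Sob 2, ∀ x ∈ Icc (0 : ℝ) 1, r.eval x = (u.eval x)⁻¹ := by
  have hc : ContinuousOn (fun x => -u.derivative.eval x / u.eval x ^ 2) (Icc 0 1) :=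
    u.derivative.continuous_eval.neg.continuousOn.div (u.continuous_eval.pow 2).continuousOn
      fun x hx => pow_ne_zero 2 (h0 x hx)
  have hftc : ∀ x ∈ Icc (0 : ℝ) 1, (u.eval x)⁻¹ =
      (u.eval 0)⁻¹ + primitive (fun x => -u.derivative.eval x / u.eval x ^ 2) x := by
    intro x hx
    have hsub : Icc 0 x ⊆ Icc (0 : ℝ) 1 := Icc_subset_Icc_right hx.2
    rw [primitive_eq hx, intervalIntegral.integral_eq_sub_of_hasDerivAt_of_le
      (f := fun x => (u.eval x)⁻¹) hx.1
      (u.continuous_eval.continuousOn.inv₀ fun y hy => h0 y (hsub hy))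
      (fun y hy => (u.hasDerivAt_eval ⟨hy.1, hy.2.trans_le hx.2⟩).inv
        (h0 y (hsub (Ioo_subset_Icc_self hy))))
      ((hc.mono (by rwa [uIcc_of_le hx.1])).intervalIntegrable)]
    ring
  have hm := memLp_unitMeasure_of_continuousOn hc
  obtain ⟨r, hr, -⟩ := exists_sob_one (f := fun x => (u.eval x)⁻¹) (w := hm.toLp) fun x hx => by
    rw [hftc x hx, primitive_congr hm.coeFn_toLp]
  have hw : ∀ x ∈ Icc (0 : ℝ) 1, ((-1 : ℂ) • r.conjMulOne (r.conjMulOne u.derivative)).eval x =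
      -u.derivative.eval x / u.eval x ^ 2 := by
    intro x hx
    rw [eval_smul, eval_conjMulOne _ _ hx, eval_conjMulOne _ _ hx, hr x hx, map_inv₀,
      hu.conj_eval hx]
    field_simp
  obtain ⟨r', hr', -⟩ := exists_sob_two (f := fun x => (u.eval x)⁻¹)
    (w := (-1 : ℂ) • r.conjMulOne (r.conjMulOne u.derivative)) fun x hx => by
      rw [hftc x hx]
      congr 1
      refine primitive_congr ?_ x
      filter_upwards [ae_restrict_mem measurableSet_Icc] with t ht using (hw t ht).symm
  exact ⟨r', hr'⟩

lemma Sob.exists_eq_conjMulTwo {u y : Sob 2} (hu : u.IsReal) (hy : y.IsReal)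
    (h0 : ∀ x ∈ Icc (0 : ℝ) 1, u.eval x ≠ 0) :
    ∃ v : Sob 2, v.IsReal ∧ u.conjMulTwo v = y := by
  obtain ⟨r, hr⟩ := Sob.exists_inv hu h0
  have hrr : r.IsReal := fun x hx => by
    rw [← Complex.conj_eq_iff_im, hr x hx, map_inv₀, hu.conj_eval hx]
  refine ⟨r.conjMulTwo y, hrr.conjMulTwo hy, Sob.ext_eval fun x hx => ?_⟩
  rw [eval_conjMulTwo _ _ hx, eval_conjMulTwo _ _ hx, hrr.conj_eval hx, hu.conj_eval hx, hr x hx,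
    mul_inv_cancel_left₀ (h0 x hx)]

/-- The restriction of `w` to an interval at whose endpoints inside `(0,1)` it vanishes. -/
lemma Sob.exists_indicator {w : Sob 1} {a b : ℝ} (ha0 : 0 ≤ a) (hab : a ≤ b)
    (ha : a = 0 ∨ w.eval a = 0) (hb : b = 1 ∨ w.eval b = 0) :
    ∃ ω : Sob 1, (∀ x ∈ Icc (0 : ℝ) 1, ω.eval x = (Icc a b).indicator w.eval x) ∧
      ω.wderiv 1 =ᵐ[unitMeasure] (Icc a b).indicator (w.wderiv 1) := by
  have hm : MemLp ((Icc a b).indicator (w.wderiv 1)) 2 unitMeasure :=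
    (Lp.memLp (w.wderiv 1)).indicator measurableSet_Icc
  have hint (c d : ℝ) : IntervalIntegrable (w.wderiv 1) unitMeasure c d :=
    (L2.integrable _).intervalIntegrable
  have hprim (x : ℝ) (hx : 0 ≤ x) : primitive ((Icc a b).indicator (w.wderiv 1)) x =
      if x < a then 0 else w.eval (min x b) - w.eval a := by
    have e : primitive ((Icc a b).indicator (w.wderiv 1)) x =
        ∫ t in Ioc 0 x ∩ Icc a b, w.wderiv 1 t ∂unitMeasure := by
      rw [primitive, intervalIntegral.integral_of_le hx, setIntegral_indicator measurableSet_Icc]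
    rw [e]
    split_ifs with h
    · have : Ioc 0 x ∩ Icc a b = ∅ := by
        ext t; simp only [mem_inter_iff, mem_Ioc, mem_Icc, mem_empty_iff_false, iff_false]
        intro ht; linarith [ht.1.2, ht.2.1]
      rw [this, Measure.restrict_empty, integral_zero_measure]
    · push Not at h
      have hle : a ≤ min x b := le_min h hab
      have hset : (Ioc 0 x ∩ Icc a b : Set ℝ) =ᵐ[unitMeasure] Ioc a (min x b) := by
        have hne : ∀ᵐ t ∂unitMeasure, t ≠ a := by
          refine ae_restrict_of_ae ?_
          simp [ae_iff, measure_singleton]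
        filter_upwards [hne] with t ht
        refine propext ?_
        change (t ∈ Ioc 0 x ∧ t ∈ Icc a b) ↔ t ∈ Ioc a (min x b)
        simp only [mem_Ioc, mem_Icc, le_min_iff]
        constructor
        · rintro ⟨⟨-, h1⟩, h2, h3⟩
          exact ⟨lt_of_le_of_ne h2 ht.symm, h1, h3⟩
        · rintro ⟨h1, h2, h3⟩
          exact ⟨⟨ha0.trans_lt h1, h2⟩, h1.le, h3⟩
      rw [Measure.restrict_congr_set hset, ← intervalIntegral.integral_of_le hle,
        w.eval_eq_add_primitive (min x b), w.eval_eq_add_primitive a, primitive, primitive,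
        add_sub_add_left_eq_sub, intervalIntegral.integral_interval_sub_left (hint _ _) (hint _ _)]
  obtain ⟨ω, h1, h2⟩ := exists_sob_one (f := (Icc a b).indicator w.eval) (w := hm.toLp)
    fun x hx => by
      rw [primitive_congr hm.coeFn_toLp, hprim x hx.1]
      -- If `a > 0`, both sides are 0 by the boundary condition at `a`; if `a = 0`, no condition is
      -- needed.
      have h0 : (Icc a b).indicator w.eval 0 = w.eval a := by
        rcases eq_or_ne a 0 with h | h
        · rw [h, indicator_of_mem (show (0 : ℝ) ∈ Icc 0 b from ⟨le_rfl, h ▸ hab⟩)]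
        · rw [indicator_of_notMem fun h' => h (le_antisymm h'.1 ha0), ha.resolve_left h]
      rw [h0]
      split_ifs with hxa
      · rw [indicator_of_notMem fun h' => hxa.not_ge h'.1, add_zero]
        exact (ha.resolve_left (ne_of_gt (hx.1.trans_lt hxa))).symm
      · push Not at hxa
        rw [add_sub_cancel]
        rcases le_or_gt x b with hxb | hxb
        · rw [indicator_of_mem (show x ∈ Icc a b from ⟨hxa, hxb⟩), min_eq_left hxb]
        · rw [indicator_of_notMem fun h' => hxb.not_ge h'.2, min_eq_right hxb.le,
            hb.resolve_left (ne_of_lt (hxb.trans_le hx.2))]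
  exact ⟨ω, h1, by rw [h2]; exact hm.coeFn_toLp⟩

lemma Sob.exists_antiderivative (ω : Sob 1) : ∃ z : Sob 2, z.eval 0 = 0 ∧ z.derivative = ω := by
  obtain ⟨z, h1, h2⟩ := exists_sob_two (f := primitive ω.eval) (w := ω) fun x _ => by
    simp [primitive]
  exact ⟨z, by rw [h1 0 (by simp)]; simp [primitive], h2⟩

lemma Sob.isReal_of_derivative {z : Sob 2} (h0 : (z.eval 0).im = 0) (h : z.derivative.IsReal) :
    z.IsReal := by
  intro x hx
  rw [z.eval_eq_add_integral hx, Complex.add_im, h0, zero_add]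
  have e := intervalIntegral.intervalIntegral_im (μ := volume) (a := 0) (b := x)
    (z.derivative.continuous_eval.intervalIntegrable 0 x)
  refine e.symm.trans ?_
  rw [intervalIntegral.integral_zero_ae]
  refine Filter.Eventually.of_forall fun t ht => ?_
  rw [uIoc_of_le hx.1] at ht
  exact h t ⟨ht.1.le, ht.2.trans hx.2⟩

/-! ### The form on real functions -/

variable {p : LInf} {q : SobDual 1} {h : SobDual 2}

lemma diffOperator_im_eq_zero (hq : q.IsReal) (hh : h.IsReal) {y z : Sob 2} (hy : y.IsReal)
    (hz : z.IsReal) : (diffOperator p q h y z).im = 0 := by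
  rw [diffOperator_apply, formValue, Complex.add_im, Complex.add_im,
    hq _ (hy.derivative.conjMulOne hz.derivative), hh _ (hy.conjMulTwo hz), add_zero, add_zero,
    ← Complex.conj_eq_iff_im, ← integral_conj]
  refine integral_congr_ae ?_
  filter_upwards [hy.conj_wderiv 2, hz.conj_wderiv 2] with x h1 h2
  simp only [map_mul, Complex.conj_ofReal, h1, h2]

lemma diffOperator_symm {y z : Sob 2} (hy : y.IsReal) (hz : z.IsReal) :
    diffOperator p q h y z = diffOperator p q h z y := by
  rw [diffOperator_apply, diffOperator_apply, formValue, formValue]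
  congr 2
  · refine integral_congr_ae ?_
    filter_upwards [hy.conj_wderiv 2, hz.conj_wderiv 2] with x h1 h2
    rw [h1, h2]; ring
  · refine congrArg q (Sob.ext_eval fun x hx => ?_)
    rw [Sob.eval_conjMulOne _ _ hx, Sob.eval_conjMulOne _ _ hx, hy.derivative.conj_eval hx,
      hz.derivative.conj_eval hx, mul_comm]
  · refine Sob.ext_eval fun x hx => ?_
    rw [Sob.eval_conjMulTwo _ _ hx, Sob.eval_conjMulTwo _ _ hx, hy.conj_eval hx,
      hz.conj_eval hx, mul_comm]

/-- This is the locality of the reduced form. By the product rule, `(ud)''(uz)'' - u''(udz)''`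
equals `u²d''z'' + 2uu'(d'z'' + d''z') + (4u'² - 2uu'')d'z'`, and `(ud)'(uz)' - u'(udz)'` equals
`u²d'z'`; the terms with `h` coincide. The hypotheses annihilate each remaining product. -/
lemma diffOperator_conjMulTwo_of_disjoint {u d z : Sob 2} (hu : u.IsReal) (hd : d.IsReal)
    (hz : z.IsReal) (h1 : ∀ x ∈ Icc (0 : ℝ) 1, d.derivative.eval x * z.derivative.eval x = 0)
    (h2 : ∀ᵐ x ∂unitMeasure, d.wderiv 2 x * z.wderiv 2 x = 0 ∧
      d.derivative.eval x * z.wderiv 2 x = 0 ∧ d.wderiv 2 x * z.derivative.eval x = 0) :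
    diffOperator p q h (u.conjMulTwo d) (u.conjMulTwo z) =
      diffOperator p q h u (u.conjMulTwo (d.conjMulTwo z)) := by
  have hud := hu.conjMulTwo hd
  have hudz := hu.conjMulTwo (hd.conjMulTwo hz)
  rw [diffOperator_apply, diffOperator_apply, formValue, formValue]
  congr 2
  · refine integral_congr_ae ?_
    filter_upwards [h2, u.wderiv_two_conjMulTwo d, u.wderiv_two_conjMulTwo z,
      u.wderiv_two_conjMulTwo (d.conjMulTwo z), d.wderiv_two_conjMulTwo z, hu.conj_wderiv 2,
      hd.conj_wderiv 2, (hu.conjMulTwo hz).conj_wderiv 2, hudz.conj_wderiv 2,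
      ae_restrict_mem measurableSet_Icc] with x e1 e2 e3 e4 e5 e6 e7 e8 e9 hx
    rw [e8, e9, e2, e3, e4, e5, Sob.eval_conjMulTwo _ _ hx,
      Sob.eval_derivative_conjMulTwo _ _ hx, e6, e7, hu.conj_eval hx, hd.conj_eval hx,
      hu.derivative.conj_eval hx, hd.derivative.conj_eval hx]
    linear_combination (p x : ℂ) * (u.eval x ^ 2 * e1.1 +
      2 * u.eval x * u.derivative.eval x * (e1.2.1 + e1.2.2) +
      (4 * u.derivative.eval x ^ 2 - 2 * u.eval x * u.wderiv 2 x) * h1 x hx)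
  · refine congrArg q (Sob.ext_eval fun x hx => ?_)
    rw [Sob.eval_conjMulOne _ _ hx, Sob.eval_conjMulOne _ _ hx, hud.derivative.conj_eval hx,
      Sob.eval_derivative_conjMulTwo _ _ hx, Sob.eval_derivative_conjMulTwo _ _ hx,
      Sob.eval_derivative_conjMulTwo _ _ hx, Sob.eval_derivative_conjMulTwo _ _ hx,
      Sob.eval_conjMulTwo _ _ hx, hu.conj_eval hx, hd.conj_eval hx,
      hu.derivative.conj_eval hx, hd.derivative.conj_eval hx]
    linear_combination u.eval x ^ 2 * h1 x hx
  · refine Sob.ext_eval fun x hx => ?_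
    rw [Sob.eval_conjMulTwo _ _ hx, Sob.eval_conjMulTwo _ _ hx, Sob.eval_conjMulTwo _ _ hx,
      Sob.eval_conjMulTwo _ _ hx, Sob.eval_conjMulTwo _ _ hx, Sob.eval_conjMulTwo _ _ hx, map_mul,
      Complex.conj_conj, hu.conj_eval hx, hd.conj_eval hx]
    ring

/-! ### The reduced second order problem and its nodal intervals -/

lemma Sob.eval_zero {n : ℕ} (x : ℝ) : (0 : Sob (n + 1)).eval x = 0 := by
  simpa using Sob.eval_smul 0 (0 : Sob (n + 1)) x

lemma Sob.continuous_re_eval {n : ℕ} (u : Sob (n + 1)) : Continuous fun x => (u.eval x).re :=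
  Complex.continuous_re.comp u.continuous_eval

lemma Sob.re_eval_sub (u : Sob 2) {a b : ℝ} (ha : a ∈ Icc (0 : ℝ) 1) (hb : b ∈ Icc (0 : ℝ) 1) :
    (u.eval b).re - (u.eval a).re = ∫ t in a..b, (u.derivative.eval t).re := by
  have hi (c d : ℝ) : IntervalIntegrable u.derivative.eval volume c d :=
    u.derivative.continuous_eval.intervalIntegrable c d
  have e := intervalIntegral.intervalIntegral_re (hi a b)
  refine Eq.trans ?_ e.symm
  rw [← intervalIntegral.integral_interval_sub_left (hi 0 b) (hi 0 a), ← Complex.sub_re,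
    u.eval_eq_add_integral hb, u.eval_eq_add_integral ha, add_sub_add_left_eq_sub]
  rfl

/-- Integration by parts against the antiderivative of `F` vanishing at 1; the boundary term at 0 is
removed by `z(0) = 0`. -/
lemma Sob.integral_mul_re_eval (z : Sob 2) (hz : z.eval 0 = 0) {F : ℝ → ℝ} (hF : Continuous F) :
    ∫ x in (0 : ℝ)..1, F x * (z.eval x).re =
      ∫ x in (0 : ℝ)..1, (∫ t in x..1, F t) * (z.derivative.eval x).re := by
  have hφ (x : ℝ) : HasDerivAt (fun x => ∫ t in x..1, F t) (-F x) x :=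
    intervalIntegral.integral_hasDerivAt_left (hF.intervalIntegrable _ _)
      hF.stronglyMeasurable.stronglyMeasurableAtFilter hF.continuousAt
  rw [intervalIntegral.integral_mul_deriv_eq_deriv_mul_of_hasDerivAt (u' := fun x => -F x)
    (v := fun x => (z.eval x).re) (fun x _ => (hφ x).continuousAt.continuousWithinAt)
    z.continuous_re_eval.continuousOn (fun x _ => hφ x)
    (fun x hx => by
      rw [min_eq_left zero_le_one, max_eq_right zero_le_one] at hx
      exact Complex.reCLM.hasFDerivAt.comp_hasDerivAt x (z.hasDerivAt_eval hx))
    (hF.neg.intervalIntegrable _ _) (z.derivative.continuous_re_eval.intervalIntegrable _ _)]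
  simp [hz]

/-- If `L u = δ_0`, then `⟨L (u v), u z⟩ > 0` whenever `z` vanishes at `0` and `z'` is the
restriction of `v'` to a nodal interval. -/
lemma diffOperator_nodal_pos (hL : IsPositiveDefinite (diffOperator p q h)) {u v : Sob 2}
    (hu : u.IsReal) (hv : v.IsReal) (hu0 : ∀ x ∈ Icc (0 : ℝ) 1, u.eval x ≠ 0)
    (hLu : ∀ z : Sob 2, z.IsReal → diffOperator p q h u z = z.eval 0) {a b η : ℝ}
    (ha0 : 0 ≤ a) (haη : a ≤ η) (hηb : η ≤ b) (hb1 : b ≤ 1) (hη : v.derivative.eval η ≠ 0)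
    (ha : a = 0 ∨ v.derivative.eval a = 0) (hb : b = 1 ∨ v.derivative.eval b = 0) :
    ∃ z : Sob 2, z.IsReal ∧ z.eval 0 = 0 ∧
      (∀ x ∈ Icc (0 : ℝ) 1, z.derivative.eval x = (Icc a b).indicator v.derivative.eval x) ∧
      0 < (diffOperator p q h (u.conjMulTwo v) (u.conjMulTwo z)).re := by
  obtain ⟨ω, hω, hω1⟩ := Sob.exists_indicator ha0 (haη.trans hηb) ha hb
  obtain ⟨z, hz0, rfl⟩ := ω.exists_antiderivative
  have hzr : z.IsReal := Sob.isReal_of_derivative (by simp [hz0]) fun x hx => by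
    rw [hω x hx]
    by_cases hx' : x ∈ Icc a b
    · rw [indicator_of_mem hx', hv.derivative x hx]
    · rw [indicator_of_notMem hx', Complex.zero_im]
  refine ⟨z, hzr, hz0, hω, ?_⟩
  have hd : (v - z).IsReal := hv.sub hzr
  have hdd (x : ℝ) : (v - z).derivative.eval x = v.derivative.eval x - z.derivative.eval x :=
    Sob.eval_sub v.derivative z.derivative x
  -- Inside `[a, b]` the derivative of `v - z` vanishes, outside it that of `z` does.
  have horth := diffOperator_conjMulTwo_of_disjoint (p := p) (q := q) (h := h) hu hd hzr
    (fun x hx => by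
      rw [hdd, hω x hx]
      by_cases hx' : x ∈ Icc a b
      · rw [indicator_of_mem hx', sub_self, zero_mul]
      · rw [indicator_of_notMem hx', mul_zero])
    (by
      have hd2 : (v - z).wderiv 2 =ᵐ[unitMeasure] fun x => v.wderiv 2 x - z.wderiv 2 x :=
        Lp.coeFn_sub _ _
      have hz2 : z.wderiv 2 =ᵐ[unitMeasure] (Icc a b).indicator (v.wderiv 2) := hω1
      filter_upwards [hd2, hz2, ae_restrict_mem measurableSet_Icc] with x h1 h2 hx
      rw [hdd, h1, h2, hω x hx]
      by_cases hx' : x ∈ Icc a b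
      · simp only [indicator_of_mem hx', sub_self, zero_mul, and_self]
      · simp only [indicator_of_notMem hx', mul_zero, and_self])
  have h0 : (0 : ℝ) ∈ Icc (0 : ℝ) 1 := by simp
  -- Since `L u = δ_0`, the right-hand side is a value at 0 containing the factor `z(0) = 0`. Thus
  -- `u(v - z)` contributes nothing and `⟨L(uz), uz⟩` remains.
  rw [hLu _ (hu.conjMulTwo (hd.conjMulTwo hzr)), Sob.eval_conjMulTwo _ _ h0,
    Sob.eval_conjMulTwo _ _ h0, hz0, mul_zero, mul_zero] at horth
  have hsplit : u.conjMulTwo v = u.conjMulTwo (v - z) + u.conjMulTwo z := by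
    rw [← Sob.conjMulTwo_add, sub_add_cancel]
  rw [hsplit, map_add, add_apply, horth, zero_add]
  refine hL _ fun huz => hη ?_
  have hz : z = 0 := Sob.ext_eval fun x hx => by
    have e := Sob.eval_conjMulTwo u z hx
    rw [huz, Sob.eval_zero, hu.conj_eval hx] at e
    rw [Sob.eval_zero]
    exact (mul_eq_zero.1 e.symm).resolve_left (hu0 x hx)
  have e := hω η ⟨ha0.trans haη, hηb.trans hb1⟩
  rw [indicator_of_mem (show η ∈ Icc a b from ⟨haη, hηb⟩), hz] at e
  rw [← e]
  exact Sob.eval_zero η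

lemma Sob.IsReal.ofReal_re {n : ℕ} {u : Sob (n + 1)} (hu : u.IsReal) {x : ℝ}
    (hx : x ∈ Icc (0 : ℝ) 1) : ((u.eval x).re : ℂ) = u.eval x :=
  Complex.ext rfl (hu x hx).symm

/-- If `L y` is a continuous function `g`, then `g` alternates as often as `y`. -/
lemma AlternatesFrom.of_diffOperator (hL : IsPositiveDefinite (diffOperator p q h)) {u y : Sob 2}
    (hu : u.IsReal) (hy : y.IsReal) (hu0 : ∀ x ∈ Icc (0 : ℝ) 1, 0 < (u.eval x).re)
    (hLu : ∀ z : Sob 2, z.IsReal → diffOperator p q h u z = z.eval 0) {g : ℝ → ℝ}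
    (hg : Continuous g) (hLy : ∀ z : Sob 2, z.IsReal →
      diffOperator p q h y z = ((∫ x in (0 : ℝ)..1, g x * (z.eval x).re : ℝ) : ℂ))
    {s : ℝ} {n : ℕ} (hA : AlternatesFrom (fun x => (y.eval x).re) s n) : AlternatesFrom g s n := by
  have hu0' : ∀ x ∈ Icc (0 : ℝ) 1, u.eval x ≠ 0 := fun x hx h => by
    have := hu0 x hx; simp [h] at this
  have h0 : (0 : ℝ) ∈ Icc (0 : ℝ) 1 := by simp
  obtain ⟨v, hv, rfl⟩ := Sob.exists_eq_conjMulTwo hu hy hu0'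
  have hre (z : Sob 2) (hz : z.IsReal) : ∀ x ∈ Icc (0 : ℝ) 1,
      ((u.conjMulTwo z).eval x).re = (z.eval x).re * (u.eval x).re := fun x hx => by
    rw [Sob.eval_conjMulTwo _ _ hx, Complex.mul_re, hz x hx, Complex.conj_re]; ring
  set F : ℝ → ℝ := fun x => g x * (u.eval x).re with hF
  have hFc : Continuous F := hg.mul u.continuous_re_eval
  set φ : ℝ → ℝ := fun x => ∫ t in x..1, F t with hφ
  have hvA : AlternatesFrom (fun x => (v.eval x).re) s n := hA.of_mul_pos hu0 (hre v hv)
  have hv' : ∀ a ∈ Icc (0 : ℝ) 1, ∀ b ∈ Icc (0 : ℝ) 1, a ≤ b →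
      (v.eval b).re - (v.eval a).re = ∫ x in a..b, (v.derivative.eval x).re :=
    fun a ha b hb _ => v.re_eval_sub ha hb
  -- `φ(0) = ∫ g u = ⟨Ly, u⟩`, which by symmetry equals `⟨Lu, y⟩ = y(0)`.
  have hφ0 : φ 0 = (v.eval 0).re * (u.eval 0).re := by
    have e := hLy u hu
    rw [diffOperator_symm hy hu, hLu _ hy] at e
    rw [← hre v hv 0 h0, e, Complex.ofReal_re]
  have hnodal (a b η : ℝ) (ha0 : 0 ≤ a) (haη : a ≤ η) (hηb : η ≤ b) (hb1 : b ≤ 1)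
      (hη : (v.derivative.eval η).re ≠ 0) (ha : a = 0 ∨ (v.derivative.eval a).re = 0)
      (hb : b = 1 ∨ (v.derivative.eval b).re = 0) :
      ∃ θ ∈ Icc a b, 0 < φ θ * (v.derivative.eval θ).re := by
    have hzero (c : ℝ) (hc : c ∈ Icc (0 : ℝ) 1) (h : (v.derivative.eval c).re = 0) :
        v.derivative.eval c = 0 := by rw [← hv.derivative.ofReal_re hc, h, Complex.ofReal_zero]
    have hab := haη.trans hηb
    obtain ⟨z, hz, hz0, hzd, hpos⟩ := diffOperator_nodal_pos hL hu hv hu0' hLu ha0 haη hηb hb1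
      (fun h => hη (by rw [h, Complex.zero_re])) (ha.imp_right (hzero a ⟨ha0, hab.trans hb1⟩))
      (hb.imp_right (hzero b ⟨ha0.trans hab, hb1⟩))
    rw [hLy _ (hu.conjMulTwo hz), Complex.ofReal_re] at hpos
    have e : ∫ x in (0 : ℝ)..1, g x * ((u.conjMulTwo z).eval x).re =
        ∫ x in (0 : ℝ)..1, F x * (z.eval x).re := by
      refine intervalIntegral.integral_congr fun x hx => ?_
      rw [uIcc_of_le zero_le_one] at hx
      simp only [hF, hre z hz x hx]; ring
    rw [e, z.integral_mul_re_eval hz0 hFc] at hpos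
    obtain ⟨θ, hθ, hθ'⟩ := exists_pos_of_intervalIntegral_pos zero_le_one hpos
    rw [hzd θ (Ioc_subset_Icc_self hθ)] at hθ'
    -- The integrand vanishes outside `[a, b]`, so the point of positivity lies inside.
    by_cases hm : θ ∈ Icc a b
    · exact ⟨θ, hm, by rwa [indicator_of_mem hm] at hθ'⟩
    · rw [indicator_of_notMem hm] at hθ'
      simp at hθ'
  have hwφ {s : ℝ} {n : ℕ} (hw : AlternatesFrom (fun x => (v.derivative.eval x).re) s n) :
      AlternatesFrom φ s n := hw.of_nodal v.derivative.continuous_re_eval hnodal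
  have hφA : AlternatesFrom φ s n := by
    -- Either 0 provides an extra increment of `v`, so that `v'` keeps all `n` alternations, or
    -- `φ(0)` has the sign of `s` and can be put in front of the `n - 1` alternations that start
    -- with `-s`.
    rcases le_or_gt (s * (v.eval 0).re) 0 with hs | hs
    · exact hwφ (hvA.of_integral_of_nonpos hs hv')
    · have hs' : 0 < s * φ 0 := by
        rw [hφ0, ← mul_assoc]; exact mul_pos hs (hu0 0 h0)
      rcases n with _ | n
      · exact ⟨fun _ => 0, fun k hk => absurd hk k.not_lt_zero, fun k hk => by
          obtain rfl := Nat.le_zero.1 hk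
          exact ⟨h0, by simpa using hs'⟩⟩
      · exact (hwφ (hvA.of_integral hv')).cons hs'
  -- The derivative of `φ` is `-F`; its minus sign cancels the reversal of `s`.
  have hFA := hφA.of_integral_of_last (g := fun x => -F x)
    (intervalIntegral.integral_same) fun a _ b _ _ => by
      rw [intervalIntegral.integral_neg]
      have e := intervalIntegral.integral_add_adjacent_intervals (μ := volume) (hFc.intervalIntegrable a b)
        (hFc.intervalIntegrable b 1)
      simp only [hφ]
      linarith
  refine AlternatesFrom.of_mul_pos (f := F) ?_ hu0 fun _ _ => rfl
  obtain ⟨ξ, h1, h2⟩ := hFA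
  exact ⟨ξ, h1, fun k hk => ⟨(h2 k hk).1, by simpa using (h2 k hk).2⟩⟩

/-- With real coefficients the form is real on real functions, so the real part of a solution solves
the problem with the real part of the right-hand side. -/
lemma diffOperator_re_eq (hq : q.IsReal) (hh : h.IsReal) (x : Sob 2) :
    ∃ a : Sob 2, a.IsReal ∧ (∀ t ∈ Icc (0 : ℝ) 1, (a.eval t).re = (x.eval t).re) ∧
      ∀ z : Sob 2, z.IsReal → diffOperator p q h a z = ((diffOperator p q h x z).re : ℂ) := by
  obtain ⟨a, b, ha, hb, hx, hre⟩ := x.exists_re_add_I_smul_im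
  refine ⟨a, ha, hre, fun z hz => ?_⟩
  have h1 := diffOperator_im_eq_zero (p := p) hq hh ha hz
  have h2 := diffOperator_im_eq_zero (p := p) hq hh hb hz
  have e : diffOperator p q h x z =
      diffOperator p q h a z + Complex.I * diffOperator p q h b z := by
    rw [hx, map_add, map_smul]; rfl
  refine Complex.ext ?_ (by rw [h1, Complex.ofReal_im])
  rw [e]; simp [h2]

lemma Alternates.congr {f g : ℝ → ℝ} {n : ℕ} (hf : Alternates f n)
    (hfg : ∀ x ∈ Icc (0 : ℝ) 1, f x = g x) : Alternates g n := by
  obtain ⟨ξ, h1, h2, h3⟩ := hf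
  refine ⟨ξ, h1, h2, fun k => ?_⟩
  rw [← hfg _ (h2 _), ← hfg _ (h2 _)]
  exact h3 k

end SobolevInterval
end

/-! ### Approximation by continuous right-hand sides -/

theorem mainTheorem2 (p : LInf) (hp : IsUniformlyPositive p)
    (q : SobDual 1) (hq : q.IsReal) (h : SobDual 2) (hh : h.IsReal)
    (hL : IsPositiveDefinite (diffOperator p q h))
    (hG : ∃ c : ℝ, 0 < c ∧ ∀ t ∈ Set.Icc (0 : ℝ) 1, ∀ s ∈ Set.Icc (0 : ℝ) 1,
      c ≤ (greenFunction (diffOperator p q h) t s).re)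
    (y : Sob 2) (hy : y.IsReal) :
    signChanges (fun x => (y.eval x).re) ≤ (diffOperator p q h y).signChanges := by
  obtain ⟨c, hc, hG⟩ := hG
  have h0 : (0 : ℝ) ∈ Icc (0 : ℝ) 1 := by simp
  set L := diffOperator p q h with hLdef
  have hgreen (t : ℝ) : greenFunction L t 0 = (L.inverse (delta 0)).eval t :=
    Complex.conj_conj _
  -- For a non-invertible operator `inverse` is 0 by convention; the Green function would vanish,
  -- contrary to its lower bound.
  have hinv : L.IsInvertible := by
    by_contra hn
    have h1 := hG 0 h0 0 h0
    rw [greenFunction, ContinuousLinearMap.inverse_of_not_isInvertible hn, zero_apply,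
      map_zero, map_zero, Complex.zero_re] at h1
    exact hc.not_ge h1
  have hLinv (f : SobDual 2) : L (L.inverse f) = f := (hinv.inverse_apply_eq.1 rfl).symm
  obtain ⟨u, hu, hure, hLu⟩ := diffOperator_re_eq (p := p) hq hh (L.inverse (delta 0))
  have hu0 : ∀ x ∈ Icc (0 : ℝ) 1, 0 < (u.eval x).re := fun x hx => by
    rw [hure x hx, ← hgreen]; exact hc.trans_le (hG x hx 0 h0)
  have hLu' : ∀ z : Sob 2, z.IsReal → diffOperator p q h u z = z.eval 0 := fun z hz => by
    rw [hLu z hz, ← hLdef, hLinv]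
    change (((starRingEnd ℂ) (z.eval 0)).re : ℂ) = _
    rw [Complex.conj_re, hz.ofReal_re h0]
  refine iSup₂_le fun m hm => le_iInf₂ fun n hn => ?_
  -- Zero alternations prescribe no sign, so this case is separated.
  rcases m.eq_zero_or_pos with rfl | hmpos
  · simp
  obtain ⟨ξ, hξm, hξI, hξ⟩ := hm
  have hcont (t : ℝ) : Continuous fun f : SobDual 2 => ((L.inverse f).eval t).re := by
    have : Continuous fun f : SobDual 2 => (delta t (L.inverse f)).re :=
      Complex.continuous_re.comp ((delta t).continuous.comp L.inverse.continuous)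
    exact this
  -- The right-hand sides whose solutions alternate at the fixed points `ξ` form an open set
  -- containing `L y`; it therefore contains an `f` given by a continuous `g` with at most `n` sign
  -- changes.
  have hopen : IsOpen {f : SobDual 2 | ∀ k : Fin m,
      ((L.inverse f).eval (ξ k.castSucc)).re * ((L.inverse f).eval (ξ k.succ)).re < 0} := by
    rw [ofPred_forall]
    exact isOpen_iInter_of_finite fun k =>
      isOpen_lt ((hcont _).mul (hcont _)) continuous_const
  obtain ⟨f, hf, g, hg, hgn, hfg⟩ := mem_closure_iff.1 hn _ hopen (by
    have e : L.inverse (L y) = y := hinv.inverse_apply_eq.2 rfl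
    intro k
    rw [e]
    exact hξ k)
  obtain ⟨x, hx, hxre, hLx⟩ := diffOperator_re_eq (p := p) hq hh (L.inverse f)
  have hxA : Alternates (fun t => (x.eval t).re) m :=
    Alternates.congr (f := fun t => ((L.inverse f).eval t).re) ⟨ξ, hξm, hξI, hf⟩ fun t ht => (hxre t ht).symm
  obtain ⟨s, hs⟩ := hxA.exists_alternatesFrom hmpos
  -- `g` is continuous only on `[0,1]`; constant continuation on both sides makes it continuous on
  -- the line without changing its values there.
  set g' : ℝ → ℝ := IccExtend (zero_le_one (α := ℝ)) ((Icc (0 : ℝ) 1).domRestrict g) with hg'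
  have hgg' : ∀ t ∈ Icc (0 : ℝ) 1, g' t = g t := fun t ht => by
    rw [hg', IccExtend_of_mem _ _ ht]; rfl
  have hgc : Continuous g' := (continuousOn_iff_continuous_domRestrict.1 hg).Icc_extend'
  have hgA : AlternatesFrom g' s m := hs.of_diffOperator hL hu hx hu0 hLu' hgc fun z hz => by
    rw [hLx z hz, ← hLdef, hLinv, hfg, intervalIntegral.integral_of_le zero_le_one,
      ← integral_Icc_eq_integral_Ioc]
    have e : ∫ t in Icc (0 : ℝ) 1, (g t : ℂ) * (starRingEnd ℂ) (z.eval t) =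
        ∫ t in Icc (0 : ℝ) 1, ((g' t * (z.eval t).re : ℝ) : ℂ) := by
      refine setIntegral_congr_fun measurableSet_Icc fun t ht => ?_
      rw [hz.conj_eval ht, hgg' t ht, Complex.ofReal_mul, hz.ofReal_re ht]
    rw [e, integral_complex_ofReal, Complex.ofReal_re]
  have hgm : Alternates g m := hgA.alternates.congr hgg'
  exact (le_iSup₂ (f := fun (n : ℕ) (_ : Alternates g n) => (n : ℕ∞)) m hgm).trans hgn
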